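/- Let $C \geq 3$ and let $P$ be a probability measure on $\mathcal{X} \times \{1,\dots,C\}$, where $\mathcal{X}$ is a measurable space and $\{1,\dots,C\}$ carries its discrete $\sigma$-algebra. Let $M \geq 1$, and let $\mathcal{G} = \prod_{k=1}^C \mathcal{G}_k$, where each $\mathcal{G}_k$ is a uniform Glivenko-Cantelli class of measurable functions from $\mathcal{X}$ to $[-M, M]$; that is, for every $\epsilon > 0$, $\sup_{Q} Q^{\infty}\big( \sup_{n' \geq n} \sup_{f \in \mathcal{G}_k} \big| \frac{1}{n'} \sum_{i=1}^{n'} f(T_i) - \int f \, dQ \big| > \epsilon \big) \to 0$ as $n \to \infty$, where $Q$ runs over all probability measures on $\mathcal{X}$ and $T_1, T_2, \dots$ are independent with law $Q$ (outer probability if the event is not measurable). Let $\gamma \in (0, 1]$, and let $\mathcal{F}_{\mathcal{G},\gamma} = \{ \pi_\gamma \circ f_g : g \in \mathcal{G} \}$, where $f_g(x,k) = \frac{1}{2} \big( g_k(x) - \max_{l \neq k} g_l(x) \big)$ and $\pi_\gamma(t) = t \, 1_{\{0 < t \leq \gamma\}} + \gamma \, 1_{\{t > \gamma\}}$. Let $m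 \geq 1$ and let $$ R_m(\mathcal{F}_{\mathcal{G},\gamma}) = \mathbb{E} \Big[ \sup_{f \in \mathcal{F}_{\mathcal{G},\gamma}} \frac{1}{m} \sum_{i=1}^m \sigma_i f(Z_i) \Big] $$ be the Rademacher complexity, where $Z_1, \dots, Z_m$ are independent with law $P$, $\sigma_1, \dots, \sigma_m$ are independent uniform signs, independent of the $Z_i$, and the expectation of the supremum over the class means the supremum, over its nonempty finite subsets, of the expectations of the maxima. For $\epsilon > 0$ let $d(\epsilon) = \max_{1 \leq k \leq C} \epsilon\text{-dim}(\mathcal{G}_k)$, where $\epsilon\text{-dim}(\mathcal{G}_k)$ is the fat-shattering dimension with margin $\epsilon$, i.e. the largest cardinality of a set $\{t_1, \dots, t_n\} \subset \mathcal{X}$ of $n$ points for which there is $b \in [-M, M]^n$ such that for every $l \in \{-1, 1\}^n$ some $f \in \mathcal{G}_k$ satisfies $l_i (f(t_i) - b_i) \geq \epsilon$ for all $i$ (it is $0$ if there is no such nonempty set, and $+\infty$ if there is no largest cardinality). Then $d(\epsilon)$ is finite for every $\epsilon \in (0, M]$. Moreover, for every positive nonincreasing function $h$ on $\mathbb{N}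 = \{0, 1, 2, \dots\}$ with $h(0) \geq \gamma$ and $h(1) \leq 2 M \sqrt{C}$, and for every integer $N \geq 1$, $$ R_m(\mathcal{F}_{\mathcal{G},\gamma}) \leq h(N) + 4 \sqrt{\frac{5C}{m}} \sum_{j=1}^N \big( h(j) + h(j-1) \big) \sqrt{ d\Big( \frac{h(j)}{96 \sqrt{C}} \Big) \ln\Big( \frac{14 M \sqrt{C}}{h(j)} \Big) }. $$ -/

import Mathlib

open MeasureTheory Set Filter Topology

noncomputable section

/-- `F` is a uniform Glivenko-Cantelli class: its members are measurable and, for every `ε > 0`,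
the supremum over all probability measures `P` of the `P^∞`-probability that, for some `n' ≥ n` and
some `f ∈ F`, the empirical mean of `f` over the first `n'` draws differs from its expectation by
more than `ε`, tends to `0` as `n → ∞`. (A measure applied to a set that is not measurable is its
outer measure.) -/
def IsUniformGC {T : Type*} [MeasurableSpace T] (F : Set (T → ℝ)) : Prop :=
  (∀ f ∈ F, Measurable f) ∧
  ∀ ε : ℝ, 0 < ε →
    Tendsto
      (fun n : ℕ => ⨆ P : ProbabilityMeasure T,
        Measure.infinitePi (fun _ : ℕ => (P : Measure T))
          {ω : ℕ → T | ∃ n' : ℕ, n ≤ n' ∧ ∃ f ∈ F,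
            ε < |(n' : ℝ)⁻¹ * ∑ i ∈ Finset.range n', f (ω i) - ∫ t, f t ∂(P : Measure T)|})
      atTop (𝓝 0)

/-- The finite set `A` is `γ`-shattered by `F`, with a witness `b` taking its values in `S`. -/
def FatShatters {T : Type*} (S : Set ℝ) (γ : ℝ) (F : Set (T → ℝ)) (A : Finset T) : Prop :=
  ∃ b : T → ℝ, (∀ t ∈ A, b t ∈ S) ∧
    ∀ l : T → ℤˣ, ∃ f ∈ F, ∀ t ∈ A, γ ≤ ((l t : ℤ) : ℝ) * (f t - b t)

/-- The fat-shattering dimension with margin `γ` of a class `F` of functions with values in `S`: the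
largest cardinality of a `γ`-shattered set, `⊤` if these cardinalities are unbounded, and `0` if no
nonempty set is `γ`-shattered. -/
def fatDim {T : Type*} (S : Set ℝ) (γ : ℝ) (F : Set (T → ℝ)) : ℕ∞ :=
  ⨆ (A : Finset T) (_ : FatShatters S γ F A), (A.card : ℕ∞)

/-- `max_k ε-dim (G_k)`, for classes `G_k` of functions with values in `[-M, M]`. -/
def maxFatDim {X : Type*} {C : ℕ} (M : ℝ) (G : Fin C → Set (X → ℝ)) (ε : ℝ) : ℕ∞ :=
  ⨆ k : Fin C, fatDim (Icc (-M) M) ε (G k)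

/-- `f_g (x, k) = (g_k x - max_{l ≠ k} g_l x) / 2`. -/
def marginFun {X : Type*} {C : ℕ} (g : Fin C → X → ℝ) (z : X × Fin C) : ℝ :=
  (1 / 2 : ℝ) * (g z.2 z.1 - ⨆ l : {l : Fin C // l ≠ z.2}, g l.1 z.1)

/-- The piecewise-linear squashing function `t 1_{0 < t ≤ γ} + γ 1_{t > γ}`. -/
def squash (γ t : ℝ) : ℝ :=
  (Ioc 0 γ).indicator (fun s => s) t + (Ioi γ).indicator (fun _ => γ) t

/-- The class of the functions `squash γ ∘ f_g`, for `g` in the product of the classes `G_k`. -/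
def squashedMarginClass {X : Type*} {C : ℕ} (G : Fin C → Set (X → ℝ)) (γ : ℝ) :
    Set (X × Fin C → ℝ) :=
  {f | ∃ g : Fin C → X → ℝ, (∀ k, g k ∈ G k) ∧ f = fun z => squash γ (marginFun g z)}

/-- For a fixed sample `t` and a nonempty finite set `S` of functions, the expectation over
independent uniform signs `σ_1, …, σ_n` of `max_{f ∈ S} (1/n) ∑ i, σ_i f (t_i)`. -/
def signMeanMax {T : Type*} {n : ℕ} (S : Finset (T → ℝ)) (hS : S.Nonempty) (t : Fin n → T) : ℝ :=
  ((2 : ℝ) ^ n)⁻¹ * ∑ σ : Fin n → ℤˣ,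
    S.sup' hS (fun f => (n : ℝ)⁻¹ * ∑ i, ((σ i : ℤ) : ℝ) * f (t i))

/-- The Rademacher complexity of `F` for samples of size `n` drawn from `P`. The expectation of the
supremum over `F` is understood, as usual for a possibly uncountable class, as the supremum over
the finite subsets of `F` of the expectations of the maxima. -/
def rademacherComplexity {T : Type*} [MeasurableSpace T] (P : Measure T) (n : ℕ)
    (F : Set (T → ℝ)) : EReal :=
  ⨆ (S : Finset (T → ℝ)) (hS : S.Nonempty) (_ : (S : Set (T → ℝ)) ⊆ F),
    ((∫ t : Fin n → T, signMeanMax S hS t ∂(Measure.pi fun _ : Fin n => P) : ℝ) : EReal)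

end

/-! The proof is Dudley's chaining, with covering numbers controlled by the fat-shattering
dimension. All estimates hold for each fixed sample, so the law `P` enters only through a final
average.

The core is the entropy bound `card_le_exp_of_separated`, in the manner of Mendelson and Vershynin,
which does not depend on the sample size. If finitely many functions are separated in empirical
quadratic mean, their values have large variance at some sample point. A threshold there, with a gap
around it, cuts the set into two pieces whose cardinalities have square roots summing to at least
that of the whole (`exists_split`). The numbers of shattered cubes (points together with levels) are
superadditive under such a cut, so by induction the set `A` shatters at least √#A cubes
(`sqrt_card_le_card_shatteredCubes`). But the supports of these cubes have size at most the
fat-shattering dimension `d`, and such partial functions are few (`pow_mul_card_le_exp`). Passing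
first to a random subsample whose size is of order log #A at a fixed scale (`exists_subsample`)
removes the original sample size from the comparison.

A maximal separated set is a net. Taking products of nets of the components gives nets of the margin
class, because the squashed margin is 1-Lipschitz; `signMeanMax_le_of_nets` then chains along the
scales `h j`. Finiteness of `d` is separate: on a huge shattered set with uniform law, every small
sample is badly unrepresentative for some member of the class. -/

section Cubes

/-! ### Superadditivity of the number of shattered cubes -/

variable {X ι κ : Type*}

/-- The finite class `B` shatters, with margin `γ`, the indices `i` in the support of the partial
function `c`, at the levels prescribed by `c`. -/
def CubeShattered (y : ι → X) (lev : κ → ℝ) (γ : ℝ) (B : Finset (X → ℝ)) (c : ι → Option κ) :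
    Prop :=
  ∀ l : ι → ℤˣ, ∃ f ∈ B, ∀ i k, c i = some k → γ ≤ ((l i : ℤ) : ℝ) * (f (y i) - lev k)

open Classical in
/-- The set of the cubes shattered by `B`. -/
noncomputable def shatteredCubes [Fintype ι] [Fintype κ] (y : ι → X) (lev : κ → ℝ) (γ : ℝ)
    (B : Finset (X → ℝ)) : Finset (ι → Option κ) :=
  Finset.univ.filter (CubeShattered y lev γ B)

lemma mem_shatteredCubes [Fintype ι] [Fintype κ] {y : ι → X} {lev : κ → ℝ} {γ : ℝ}
    {B : Finset (X → ℝ)} {c : ι → Option κ} :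
    c ∈ shatteredCubes y lev γ B ↔ CubeShattered y lev γ B c := by
  simp [shatteredCubes]

lemma CubeShattered.mono {y : ι → X} {lev : κ → ℝ} {γ : ℝ} {B B' : Finset (X → ℝ)}
    {c : ι → Option κ} (h : CubeShattered y lev γ B c) (hB : B ⊆ B') :
    CubeShattered y lev γ B' c := by
  intro l
  obtain ⟨f, hf, h⟩ := h l
  exact ⟨f, hB hf, h⟩

/-- If two subclasses are separated at index `i` and level `k`, the numbers of cubes that they
shatter add up. -/
lemma card_shatteredCubes_add_le [Fintype ι] [Fintype κ] {y : ι → X} {lev : κ → ℝ} {γ : ℝ}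
    (hγ : 0 < γ) {B B₁ B₂ : Finset (X → ℝ)} (h₁ : B₁ ⊆ B) (h₂ : B₂ ⊆ B) (i : ι) (k : κ)
    (hB₁ : ∀ f ∈ B₁, γ ≤ f (y i) - lev k) (hB₂ : ∀ f ∈ B₂, γ ≤ lev k - f (y i)) :
    (shatteredCubes y lev γ B₁).card + (shatteredCubes y lev γ B₂).card ≤
      (shatteredCubes y lev γ B).card := by
  classical
  set S₁ := shatteredCubes y lev γ B₁
  set S₂ := shatteredCubes y lev γ B₂
  -- A level of `c` at `i` would have to exceed `lev k` for `B₁` to go below it, and to be less than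
  -- `lev k` for `B₂` to go above it.
  have hnone : ∀ c ∈ S₁ ∩ S₂, c i = none := by
    intro c hc
    rw [Finset.mem_inter, mem_shatteredCubes, mem_shatteredCubes] at hc
    by_contra hne
    obtain ⟨k', hk'⟩ := Option.ne_none_iff_exists'.1 hne
    obtain ⟨f, hf, hf'⟩ := hc.1 (fun _ => -1)
    obtain ⟨g, hg, hg'⟩ := hc.2 (fun _ => 1)
    have e1 := hf' i k' hk'
    have e2 := hg' i k' hk'
    have e3 := hB₁ f hf
    have e4 := hB₂ g hg
    push_cast at e1 e2
    simp at e1 e2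
    linarith
  have hinj : Set.InjOn (fun c : ι → Option κ => Function.update c i (some k))
      (S₁ ∩ S₂ : Finset (ι → Option κ)) := by
    intro c hc c' hc' h
    funext j
    by_cases hj : j = i
    · subst hj
      rw [hnone c hc, hnone c' hc']
    · simpa [hj] using congrFun h j
  -- Adding `(i, k)` to a cube shattered by both pieces gives one that neither piece shatters, but
  -- their union does. These new cubes make up for those counted twice.
  have hdisj : Disjoint (S₁ ∪ S₂)
      ((S₁ ∩ S₂).image (fun c : ι → Option κ => Function.update c i (some k))) := by
    rw [Finset.disjoint_left]
    intro c hc hc'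
    obtain ⟨c', -, rfl⟩ := Finset.mem_image.1 hc'
    rw [Finset.mem_union, mem_shatteredCubes, mem_shatteredCubes] at hc
    rcases hc with hc | hc
    · obtain ⟨f, hf, hf'⟩ := hc (fun _ => -1)
      have e1 := hf' i k (by simp)
      have e3 := hB₁ f hf
      push_cast at e1
      simp at e1
      linarith
    · obtain ⟨f, hf, hf'⟩ := hc (fun _ => 1)
      have e1 := hf' i k (by simp)
      have e3 := hB₂ f hf
      push_cast at e1
      simp at e1
      linarith
  have hsub : (S₁ ∪ S₂) ∪
      ((S₁ ∩ S₂).image (fun c : ι → Option κ => Function.update c i (some k))) ⊆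
      shatteredCubes y lev γ B := by
    intro c hc
    rw [mem_shatteredCubes]
    rcases Finset.mem_union.1 hc with hc | hc
    · rcases Finset.mem_union.1 hc with hc | hc
      · exact (mem_shatteredCubes.1 hc).mono h₁
      · exact (mem_shatteredCubes.1 hc).mono h₂
    · obtain ⟨c', hc', rfl⟩ := Finset.mem_image.1 hc
      have hn := hnone c' hc'
      rw [Finset.mem_inter, mem_shatteredCubes, mem_shatteredCubes] at hc'
      intro l
      rcases Int.units_eq_one_or (l i) with hl | hl
      · obtain ⟨f, hf, hf'⟩ := hc'.1 l
        refine ⟨f, h₁ hf, fun j k' hj => ?_⟩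
        by_cases hji : j = i
        · subst hji
          have : k = k' := by simpa using hj
          subst this
          simpa [hl] using hB₁ f hf
        · exact hf' j k' (by simpa [hji] using hj)
      · obtain ⟨f, hf, hf'⟩ := hc'.2 l
        refine ⟨f, h₂ hf, fun j k' hj => ?_⟩
        by_cases hji : j = i
        · subst hji
          have : k = k' := by simpa using hj
          subst this
          simpa [hl] using hB₂ f hf
        · exact hf' j k' (by simpa [hji] using hj)
  calc S₁.card + S₂.card = (S₁ ∪ S₂).card + (S₁ ∩ S₂).card :=
        (Finset.card_union_add_card_inter _ _).symm
    _ = ((S₁ ∪ S₂) ∪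
      ((S₁ ∩ S₂).image (fun c : ι → Option κ => Function.update c i (some k)))).card := by
        rw [Finset.card_union_of_disjoint hdisj, Finset.card_image_of_injOn hinj]
    _ ≤ _ := Finset.card_le_card hsub

end Cubes

/-! ### Splitting values of large variance by a threshold -/

section Threshold

variable {α : Type*}

lemma sqrt_le_sqrt_sub_add_sqrt {N u v : ℝ} (hu : 0 ≤ u) (huN : 2 * u ≤ N) (huv : u / 2 ≤ v) :
    √N ≤ √(N - u) + √v := by
  have h1 : u / 2 ≤ √(N - u) * √v := by
    rw [← Real.sqrt_mul (by linarith)]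
    apply Real.le_sqrt_of_sq_le
    nlinarith
  rw [Real.sqrt_le_left (by positivity)]
  have h2 := Real.sq_sqrt (show 0 ≤ N - u by linarith)
  have h3 := Real.sq_sqrt (show 0 ≤ v by linarith)
  nlinarith

lemma sum_range_two_mul_add_one (j : ℕ) :
    ∑ k ∈ Finset.range j, (2 * (k : ℝ) + 1) = (j : ℝ) ^ 2 := by
  induction j with
  | zero => simp
  | succ j ih => rw [Finset.sum_range_succ, ih]; push_cast; ring

lemma sum_range_two_mul_add_one_div_le (K : ℕ) :
    ∑ k ∈ Finset.range K, (2 * (k : ℝ) + 1) / 2 ^ (k + 1) ≤ 3 := by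
  have : ∑ k ∈ Finset.range K, (2 * (k : ℝ) + 1) / 2 ^ (k + 1) = 3 - (2 * K + 3) / 2 ^ K := by
    induction K with
    | zero => norm_num
    | succ K ih =>
      rw [Finset.sum_range_succ, ih, pow_succ]
      push_cast
      field_simp
      ring
  rw [this]
  have : (0 : ℝ) ≤ (2 * K + 3) / 2 ^ K := by positivity
  linarith

/-- Discrete layer-cake formula: round `v` up to a multiple `2 δ j` and write `j ^ 2` as the sum of
the first `j` odd numbers. -/
lemma sq_max_le_sum {δ v : ℝ} (hδ : 0 < δ) {K : ℕ} (hv : v ≤ 2 * δ * K) :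
    (max v 0) ^ 2 ≤
      4 * δ ^ 2 * ∑ k ∈ Finset.range K, (2 * (k : ℝ) + 1) * (if 2 * δ * k < v then 1 else 0) := by
  rcases le_or_gt v 0 with h0 | h0
  · rw [max_eq_right h0, zero_pow two_ne_zero]
    have : 0 ≤ ∑ k ∈ Finset.range K, (2 * (k : ℝ) + 1) * (if 2 * δ * k < v then 1 else 0) :=
      Finset.sum_nonneg fun k _ => by positivity
    positivity
  rw [max_eq_left h0.le]
  set j := ⌈v / (2 * δ)⌉₊
  have hjK : j ≤ K := Nat.ceil_le.2 (by rw [div_le_iff₀ (by positivity)]; linarith)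
  have hvj : v ≤ 2 * δ * j := by
    have := Nat.le_ceil (v / (2 * δ))
    rw [div_le_iff₀ (by positivity)] at this
    linarith
  have h1 : ∑ k ∈ Finset.range j, (2 * (k : ℝ) + 1) ≤
      ∑ k ∈ Finset.range K, (2 * (k : ℝ) + 1) * (if 2 * δ * k < v then 1 else 0) := by
    calc ∑ k ∈ Finset.range j, (2 * (k : ℝ) + 1) =
        ∑ k ∈ Finset.range j, (2 * (k : ℝ) + 1) * (if 2 * δ * k < v then 1 else 0) := by
          refine Finset.sum_congr rfl fun k hk => ?_
          have : (k : ℝ) < v / (2 * δ) := Nat.lt_ceil.1 (Finset.mem_range.1 hk)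
          rw [lt_div_iff₀ (by positivity)] at this
          rw [if_pos (by linarith), mul_one]
      _ ≤ _ := Finset.sum_le_sum_of_subset_of_nonneg (Finset.range_subset_range.2 hjK)
          fun k _ _ => by positivity
  rw [sum_range_two_mul_add_one] at h1
  calc v ^ 2 ≤ (2 * δ * j) ^ 2 := by gcongr
    _ = 4 * δ ^ 2 * (j : ℝ) ^ 2 := by ring
    _ ≤ _ := by gcongr

/-- A one-sided second moment bound about a level which at most half of the values exceed, when no
threshold splits the values well. -/
lemma sum_sq_max_le_of_no_split (B : Finset α) (φ : α → ℝ) {δ m : ℝ} (hδ : 0 < δ)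
    (hm : 2 * (B.filter fun f => m < φ f).card ≤ B.card)
    (hno : ∀ a, 0 < (B.filter fun f => a + δ ≤ φ f).card →
      0 < (B.filter fun f => φ f ≤ a - δ).card →
      √(B.filter fun f => φ f ≤ a - δ).card + √(B.filter fun f => a + δ ≤ φ f).card <
        √B.card) :
    -- Without a good threshold, the upper tail at least halves at each step of length `2 δ`. The
    -- constant is 12 = 4 · 3, where 3 bounds the sum of (2k + 1) / 2 ^ (k + 1).
    ∑ f ∈ B, (max (φ f - m) 0) ^ 2 ≤ 12 * δ ^ 2 * B.card := by
  have htail : ∀ k : ℕ, ((B.filter fun f => 2 * δ * k < φ f - m).card : ℝ) ≤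
      B.card / 2 ^ (k + 1) := by
    intro k
    induction k with
    | zero =>
      have : ((2 * (B.filter fun f => m < φ f).card : ℕ) : ℝ) ≤ B.card := by exact_mod_cast hm
      push_cast at this
      simp only [Nat.cast_zero, mul_zero, sub_pos, zero_add, pow_one]
      linarith
    | succ k ih =>
      set u : ℝ := ((B.filter fun f => 2 * δ * k < φ f - m).card : ℝ) with hu
      set U := B.filter fun f => (m + δ * (2 * k + 1)) + δ ≤ φ f with hU
      have hle : ((B.filter fun f => 2 * δ * ((k + 1 : ℕ) : ℝ) < φ f - m).card : ℝ) ≤ U.card := by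
        norm_cast
        apply Finset.card_le_card
        intro f
        simp only [hU, Finset.mem_filter]
        rintro ⟨h1, h2⟩
        refine ⟨h1, ?_⟩
        push_cast at h2
        linarith
      -- Otherwise the threshold `m + δ (2k + 1)`, in the middle of the step, splits well by
      -- `sqrt_le_sqrt_sub_add_sqrt`.
      have key : (U.card : ℝ) ≤ u / 2 := by
        by_contra hcon
        push Not at hcon
        have hu0 : 0 ≤ u := by positivity
        have hUpos : 0 < U.card := by
          have : (0 : ℝ) < U.card := by linarith
          exact_mod_cast this
        have hBpos : (0 : ℝ) < B.card := by
          have : U.card ≤ B.card := Finset.card_filter_le _ _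
          exact_mod_cast lt_of_lt_of_le hUpos this
        have h2u : 2 * u ≤ B.card := by
          have : (B.card : ℝ) / 2 ^ (k + 1) ≤ B.card / 2 := by
            apply div_le_div_of_nonneg_left hBpos.le (by norm_num)
            rw [pow_succ]
            linarith [one_le_pow₀ (show (1 : ℝ) ≤ 2 by norm_num) (n := k)]
          linarith
        have hL : ((B.filter fun f => φ f ≤ (m + δ * (2 * k + 1)) - δ).card : ℝ) =
            B.card - u := by
          have := B.card_filter_add_card_filter_not (fun f => 2 * δ * k < φ f - m)
          have h3 : (B.filter fun f => φ f ≤ (m + δ * (2 * k + 1)) - δ) =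
              B.filter fun f => ¬ (2 * δ * k < φ f - m) := by
            apply Finset.filter_congr
            intro f _
            rw [not_lt]
            constructor <;> intro h <;> linarith
          rw [h3, hu, ← this]
          push_cast
          ring
        have hLpos : 0 < (B.filter fun f => φ f ≤ (m + δ * (2 * k + 1)) - δ).card := by
          have : (0 : ℝ) < (B.filter fun f => φ f ≤ (m + δ * (2 * k + 1)) - δ).card := by
            rw [hL]; linarith
          exact_mod_cast this
        have := hno _ hUpos hLpos
        rw [hL] at this
        exact absurd (sqrt_le_sqrt_sub_add_sqrt hu0 h2u hcon.le) (not_le.2 this)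
      calc _ ≤ (U.card : ℝ) := hle
        _ ≤ u / 2 := key
        _ ≤ (B.card / 2 ^ (k + 1)) / 2 := by gcongr
        _ = _ := by rw [pow_succ _ (k + 1)]; field_simp
  obtain ⟨K, hK⟩ : ∃ K : ℕ, ∀ f ∈ B, φ f - m ≤ 2 * δ * K := by
    obtain ⟨c, hc⟩ := (B.finite_toSet.image (fun f => φ f - m)).bddAbove
    obtain ⟨K, hK⟩ := exists_nat_ge (c / (2 * δ))
    refine ⟨K, fun f hf => ?_⟩
    rw [div_le_iff₀ (by positivity)] at hK
    linarith [hc (Set.mem_image_of_mem (fun f => φ f - m) (Finset.mem_coe.2 hf))]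
  calc ∑ f ∈ B, (max (φ f - m) 0) ^ 2
      ≤ ∑ f ∈ B, 4 * δ ^ 2 * ∑ k ∈ Finset.range K,
          (2 * (k : ℝ) + 1) * (if 2 * δ * k < φ f - m then 1 else 0) :=
        Finset.sum_le_sum fun f hf => sq_max_le_sum hδ (hK f hf)
    _ = 4 * δ ^ 2 * ∑ k ∈ Finset.range K,
          (2 * (k : ℝ) + 1) * ((B.filter fun f => 2 * δ * k < φ f - m).card : ℝ) := by
        rw [← Finset.mul_sum, Finset.sum_comm]
        simp_rw [← Finset.mul_sum, Finset.sum_boole]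
    _ ≤ 4 * δ ^ 2 * ∑ k ∈ Finset.range K, (2 * (k : ℝ) + 1) * (B.card / 2 ^ (k + 1)) := by
        gcongr with k _
        exact htail k
    _ = 4 * δ ^ 2 * B.card * ∑ k ∈ Finset.range K, (2 * (k : ℝ) + 1) / 2 ^ (k + 1) := by
        rw [mul_assoc (4 * δ ^ 2), Finset.mul_sum (a := (B.card : ℝ))]
        congr 1
        refine Finset.sum_congr rfl fun k _ => by ring
    _ ≤ 4 * δ ^ 2 * B.card * 3 := by
        gcongr
        exact sum_range_two_mul_add_one_div_le K
    _ = _ := by ring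

/-- The least attained value with at most half of the values above it is a median: the next smaller
attained value fails this condition. -/
lemma exists_median (B : Finset α) (φ : α → ℝ) : ∃ m : ℝ,
    2 * (B.filter fun f => m < φ f).card ≤ B.card ∧
    2 * (B.filter fun f => φ f < m).card ≤ B.card := by
  classical
  rcases B.eq_empty_or_nonempty with rfl | hB
  · exact ⟨0, by simp⟩
  set V := (B.image φ).filter fun v => 2 * (B.filter fun f => v < φ f).card ≤ B.card
  have hV : V.Nonempty := by
    refine ⟨(B.image φ).max' (hB.image _), ?_⟩
    refine Finset.mem_filter.2 ⟨Finset.max'_mem _ _, ?_⟩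
    rw [Finset.filter_false_of_mem]
    · simp
    · intro f hf
      exact not_lt.2 (Finset.le_max' _ _ (Finset.mem_image_of_mem _ hf))
  refine ⟨V.min' hV, (Finset.mem_filter.1 (V.min'_mem hV)).2, ?_⟩
  set m := V.min' hV
  rcases (B.filter fun f => φ f < m).eq_empty_or_nonempty with h | h
  · simp [h]
  obtain ⟨g, hg, hmax⟩ := Finset.exists_max_image _ φ h
  obtain ⟨hgB, hgm⟩ := Finset.mem_filter.1 hg
  have hgV : φ g ∉ V := fun hmem => absurd (V.min'_le _ hmem) (not_le.2 hgm)
  have hgt : B.card < 2 * (B.filter fun f => φ g < φ f).card := by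
    by_contra hcon
    exact hgV (Finset.mem_filter.2 ⟨Finset.mem_image_of_mem _ hgB, not_lt.1 hcon⟩)
  have := B.card_filter_add_card_filter_not (fun f => φ g < φ f)
  have hle : (B.filter fun f => φ f < m).card ≤ (B.filter fun f => ¬ φ g < φ f).card := by
    apply Finset.card_le_card
    intro f hf
    exact Finset.mem_filter.2 ⟨(Finset.mem_filter.1 hf).1, not_lt.2 (hmax f hf)⟩
  omega

/-- Values of large variance are split well by some threshold. -/
lemma exists_split (B : Finset α) (φ : α → ℝ) {δ : ℝ} (hδ : 0 < δ)
    (hvar : ∀ m : ℝ, 24 * δ ^ 2 * B.card < ∑ f ∈ B, (φ f - m) ^ 2) :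
    ∃ a, 0 < (B.filter fun f => a + δ ≤ φ f).card ∧
      0 < (B.filter fun f => φ f ≤ a - δ).card ∧
      √B.card ≤
        √(B.filter fun f => a + δ ≤ φ f).card + √(B.filter fun f => φ f ≤ a - δ).card := by
  by_contra hcon
  push Not at hcon
  obtain ⟨m, hm1, hm2⟩ := exists_median B φ
  have h1 := sum_sq_max_le_of_no_split B φ hδ hm1 fun a ha hb => by
    rw [add_comm]
    exact hcon a ha hb
  have e1 : ∀ a f, (a + δ ≤ -φ f ↔ φ f ≤ -a - δ) := fun a f => by
    constructor <;> intro h <;> linarith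
  have e2 : ∀ a f, (-φ f ≤ a - δ ↔ -a + δ ≤ φ f) := fun a f => by
    constructor <;> intro h <;> linarith
  have h2 := sum_sq_max_le_of_no_split B (fun f => -φ f) (m := -m) hδ (by simpa using hm2)
    fun a ha hb => by
      simp only [e1, e2] at ha hb ⊢
      exact hcon (-a) hb ha
  have h3 : ∑ f ∈ B, (φ f - m) ^ 2 =
      ∑ f ∈ B, (max (φ f - m) 0) ^ 2 + ∑ f ∈ B, (max (-φ f - -m) 0) ^ 2 := by
    rw [← Finset.sum_add_distrib]
    refine Finset.sum_congr rfl fun f _ => ?_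
    rcases le_total (φ f) m with h | h
    · rw [max_eq_right (by linarith), max_eq_left (by linarith)]; ring
    · rw [max_eq_left (by linarith), max_eq_right (by linarith)]; ring
  have := hvar m
  linarith

end Threshold

/-! ### Separated classes shatter many cubes -/

lemma sum_sum_sq_sub_le {α : Type*} (B : Finset α) (φ : α → ℝ) (m : ℝ) :
    ∑ f ∈ B, ∑ g ∈ B, (φ f - φ g) ^ 2 ≤ 2 * B.card * ∑ f ∈ B, (φ f - m) ^ 2 := by
  have h : ∀ f g, (φ f - φ g) ^ 2 =
      (φ f - m) ^ 2 + (φ g - m) ^ 2 - 2 * ((φ f - m) * (φ g - m)) := fun f g => by ring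
  simp_rw [h, Finset.sum_sub_distrib, Finset.sum_add_distrib, ← Finset.mul_sum, ← Finset.sum_mul,
    Finset.sum_const, nsmul_eq_mul, ← Finset.mul_sum]
  nlinarith [mul_self_nonneg (∑ f ∈ B, (φ f - m))]

/-- A class that is separated in quadratic mean on `y` shatters at least `√#B` cubes. -/
lemma sqrt_card_le_card_shatteredCubes {X ι κ : Type*} [Fintype ι] [Nonempty ι] [Fintype κ]
    (y : ι → X) (lev : κ → ℝ) {M γ δ τ : ℝ} (hγ : 0 < γ) (hδ : 0 < δ) (hτ : 96 * δ ^ 2 < τ ^ 2)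
    (hlev : ∀ a ∈ Icc (-M) M, ∃ k, |lev k - a| ≤ δ - γ) (B : Finset (X → ℝ))
    (hM : ∀ f ∈ B, ∀ x, f x ∈ Icc (-M) M)
    (hsep : ∀ f ∈ B, ∀ g ∈ B, f ≠ g → Fintype.card ι * τ ^ 2 ≤ ∑ i, (f (y i) - g (y i)) ^ 2) :
    √(B.card : ℝ) ≤ (shatteredCubes y lev γ B).card := by
  classical
  induction hn : B.card using Nat.strong_induction_on generalizing B with
  | _ N ih =>
  rcases Nat.lt_or_ge N 2 with hN | hN
  · rcases B.eq_empty_or_nonempty with rfl | ⟨f, hf⟩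
    · simp at hn
      simp [← hn]
    · have h1 : (fun _ => none) ∈ shatteredCubes y lev γ B := by
        rw [mem_shatteredCubes]
        exact fun l => ⟨f, hf, fun i k h => by simp at h⟩
      have h2 : (1 : ℝ) ≤ (shatteredCubes y lev γ B).card := by
        exact_mod_cast Finset.card_pos.2 ⟨_, h1⟩
      have h3 : (N : ℝ) ≤ 1 := by exact_mod_cast Nat.lt_succ_iff.1 hN
      exact (Real.sqrt_le_one.2 h3).trans h2
  -- Otherwise the mean over the points of the summed squared distances of pairs is at most `48 δ²
  -- N²`, while separation makes it at least `N (N - 1) τ² ≥ N² τ² / 2`; hence the 96 in `hτ`.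
  obtain ⟨i, hi⟩ : ∃ i, ∀ m : ℝ, 24 * δ ^ 2 * B.card < ∑ f ∈ B, (f (y i) - m) ^ 2 := by
    by_contra hcon
    push Not at hcon
    choose m hm using hcon
    have hq : (0 : ℝ) < Fintype.card ι := by exact_mod_cast Fintype.card_pos
    have hN' : (2 : ℝ) ≤ B.card := by rw [hn]; exact_mod_cast hN
    have up : ∑ f ∈ B, ∑ g ∈ B, ∑ i, (f (y i) - g (y i)) ^ 2 ≤
        Fintype.card ι * (48 * δ ^ 2 * (B.card : ℝ) ^ 2) := by
      have : ∑ f ∈ B, ∑ g ∈ B, ∑ i, (f (y i) - g (y i)) ^ 2 =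
          ∑ i, ∑ f ∈ B, ∑ g ∈ B, (f (y i) - g (y i)) ^ 2 := by
        rw [Finset.sum_comm]
        rw [Finset.sum_congr rfl fun f _ => Finset.sum_comm]
        rw [Finset.sum_comm]
        exact Finset.sum_congr rfl fun i _ => Finset.sum_comm
      rw [this, ← nsmul_eq_mul, ← Finset.card_univ]
      refine Finset.sum_le_card_nsmul _ _ _ fun i _ => ?_
      refine (sum_sum_sq_sub_le B (fun f => f (y i)) (m i)).trans ?_
      calc 2 * (B.card : ℝ) * ∑ f ∈ B, (f (y i) - m i) ^ 2
          ≤ 2 * (B.card : ℝ) * (24 * δ ^ 2 * B.card) := by gcongr; exact hm i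
        _ = _ := by ring
    have low : (B.card : ℝ) * ((B.card - 1) * (Fintype.card ι * τ ^ 2)) ≤
        ∑ f ∈ B, ∑ g ∈ B, ∑ i, (f (y i) - g (y i)) ^ 2 := by
      rw [← nsmul_eq_mul]
      refine Finset.card_nsmul_le_sum _ _ _ fun f hf => ?_
      have hc : ((B.card : ℝ) - 1) = ((B.erase f).card : ℝ) := by
        rw [Finset.card_erase_of_mem hf, Nat.cast_sub (by omega)]; simp
      rw [hc, ← nsmul_eq_mul]
      calc _ ≤ ∑ g ∈ B.erase f, ∑ i, (f (y i) - g (y i)) ^ 2 :=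
            Finset.card_nsmul_le_sum _ _ _ fun g hg =>
              hsep f hf g (Finset.mem_of_mem_erase hg) (Finset.ne_of_mem_erase hg).symm
        _ ≤ _ := Finset.sum_le_sum_of_subset_of_nonneg (Finset.erase_subset _ _)
            fun g _ _ => Finset.sum_nonneg fun i _ => sq_nonneg _
    have h := low.trans up
    have h' : (Fintype.card ι : ℝ) * ((B.card : ℝ) * ((B.card - 1) * τ ^ 2)) ≤
        Fintype.card ι * ((B.card : ℝ) * (48 * δ ^ 2 * B.card)) := by linarith
    have h'' := le_of_mul_le_mul_left (le_of_mul_le_mul_left h' hq) (by linarith)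
    nlinarith [sq_nonneg τ, sq_nonneg δ]
  obtain ⟨a, hU, hL, hs⟩ := exists_split B (fun f => f (y i)) hδ hi
  set B₁ := B.filter fun f => a + δ ≤ f (y i) with hB₁
  set B₂ := B.filter fun f => f (y i) ≤ a - δ with hB₂
  obtain ⟨f₁, hf₁⟩ := Finset.card_pos.1 hU
  obtain ⟨f₂, hf₂⟩ := Finset.card_pos.1 hL
  obtain ⟨hf₁B, hf₁a⟩ := Finset.mem_filter.1 hf₁
  obtain ⟨hf₂B, hf₂a⟩ := Finset.mem_filter.1 hf₂
  -- Replacing `a` by a level of the grid costs `δ - γ` and leaves a gap `γ` on each side.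
  obtain ⟨k, hk⟩ := hlev a ⟨by linarith [(hM f₂ hf₂B (y i)).1], by linarith [(hM f₁ hf₁B (y i)).2]⟩
  rw [abs_le] at hk
  have hs₁ : B₁ ⊆ B := Finset.filter_subset _ _
  have hs₂ : B₂ ⊆ B := Finset.filter_subset _ _
  have hlt₁ : B₁.card < N := by
    rw [← hn]
    refine Finset.card_lt_card (Finset.ssubset_iff_subset_ne.2 ⟨hs₁, fun h => ?_⟩)
    have := (Finset.mem_filter.1 (h ▸ hf₂B : f₂ ∈ B₁)).2
    linarith
  have hlt₂ : B₂.card < N := by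
    rw [← hn]
    refine Finset.card_lt_card (Finset.ssubset_iff_subset_ne.2 ⟨hs₂, fun h => ?_⟩)
    have := (Finset.mem_filter.1 (h ▸ hf₁B : f₁ ∈ B₂)).2
    linarith
  have i₁ := ih _ hlt₁ B₁ (fun f hf => hM f (hs₁ hf))
    (fun f hf g hg => hsep f (hs₁ hf) g (hs₁ hg)) rfl
  have i₂ := ih _ hlt₂ B₂ (fun f hf => hM f (hs₂ hf))
    (fun f hf g hg => hsep f (hs₂ hf) g (hs₂ hg)) rfl
  have hadd := card_shatteredCubes_add_le (y := y) (lev := lev) hγ hs₁ hs₂ i k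
    (fun f hf => by linarith [(Finset.mem_filter.1 hf).2])
    (fun f hf => by linarith [(Finset.mem_filter.1 hf).2])
  have hadd' : ((shatteredCubes y lev γ B₁).card : ℝ) + (shatteredCubes y lev γ B₂).card ≤
      (shatteredCubes y lev γ B).card := by exact_mod_cast hadd
  rw [← hn]
  linarith

/-! ### Packing numbers: subsampling and counting cubes -/

lemma exp_neg_le_one_sub_half {x : ℝ} (h0 : 0 ≤ x) (h1 : x ≤ 1) : Real.exp (-x) ≤ 1 - x / 2 := by
  have h := Real.add_one_le_exp x
  have : Real.exp (-x) * Real.exp x = 1 := by rw [← Real.exp_add]; simp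
  have hpos := Real.exp_pos (-x)
  nlinarith [mul_le_mul_of_nonneg_left h hpos.le]

/-- Some subsample of size `q` keeps a fixed proportion of the mean distances between the members
of a finite set. -/
lemma exists_subsample {α : Type*} {n q : ℕ} (A : Finset α) (hA : A.Nonempty)
    (D : α → α → Fin n → ℝ) (hD : ∀ f ∈ A, ∀ g ∈ A, ∀ i, D f g i ∈ Icc (0 : ℝ) 1) {p : ℝ}
    (hn : 0 < n) (hp : ∀ f ∈ A, ∀ g ∈ A, f ≠ g → n * p ≤ ∑ i, D f g i)
    (hq : 8 * Real.log A.card ≤ q * p) :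
    ∃ ω : Fin q → Fin n, ∀ f ∈ A, ∀ g ∈ A, f ≠ g → q * p / 4 ≤ ∑ j, D f g (ω j) := by
  classical
  by_contra hcon
  push Not at hcon
  have hA0 : 0 < A.card := Finset.card_pos.2 hA
  have hA1 : (0 : ℝ) < A.card := by exact_mod_cast hA0
  have hn0 : (0 : ℝ) < n := by exact_mod_cast hn
  -- Chernoff and union bounds, by counting: every bad `ω` has a pair with a term at least 1,
  -- whereas each pair contributes at most a fraction `1 / #A ^ 2` of all `ω`, and there are fewer
  -- than `#A ^ 2` pairs.
  have low : (n : ℝ) ^ q ≤ ∑ ω : Fin q → Fin n, ∑ fg ∈ A.offDiag,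
      Real.exp (q * p / 4) * ∏ j, Real.exp (-D fg.1 fg.2 (ω j)) := by
    have : ((Finset.univ : Finset (Fin q → Fin n)).card : ℝ) = (n : ℝ) ^ q := by simp
    rw [← this, ← mul_one (Finset.card _ : ℝ), ← nsmul_eq_mul]
    refine Finset.card_nsmul_le_sum _ _ _ fun ω _ => ?_
    obtain ⟨f, hf, g, hg, hfg, h⟩ := hcon ω
    refine le_trans ?_ (Finset.single_le_sum (f := fun fg : α × α =>
      Real.exp (q * p / 4) * ∏ j, Real.exp (-D fg.1 fg.2 (ω j)))
      (fun fg _ => by positivity) (Finset.mem_offDiag.2 ⟨hf, hg, hfg⟩ : (f, g) ∈ A.offDiag))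
    rw [← Real.exp_sum, ← Real.exp_add, Finset.sum_neg_distrib]
    exact Real.one_le_exp (by linarith)
  rw [Finset.sum_comm] at low
  have up : ∀ fg ∈ A.offDiag, ∑ ω : Fin q → Fin n,
      Real.exp (q * p / 4) * ∏ j, Real.exp (-D fg.1 fg.2 (ω j)) ≤
      (n : ℝ) ^ q / (A.card : ℝ) ^ 2 := by
    rintro ⟨f, g⟩ hfg
    obtain ⟨hf, hg, hne⟩ := Finset.mem_offDiag.1 hfg
    have e1 : ∑ ω : Fin q → Fin n, ∏ j, Real.exp (-D f g (ω j)) =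
        (∑ i, Real.exp (-D f g i)) ^ q := by
      have := Finset.prod_univ_sum (fun _ : Fin q => (Finset.univ : Finset (Fin n)))
        (fun _ i => Real.exp (-D f g i))
      simp only [Fintype.piFinset_univ] at this
      rw [← this]
      simp
    have e2 : ∑ i, Real.exp (-D f g i) ≤ n * Real.exp (-(p / 2)) := by
      calc ∑ i, Real.exp (-D f g i) ≤ ∑ i, (1 - D f g i / 2) := by
            refine Finset.sum_le_sum fun i _ => ?_
            exact exp_neg_le_one_sub_half (hD f hf g hg i).1 (hD f hf g hg i).2
        _ = n - (∑ i, D f g i) / 2 := by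
            rw [Finset.sum_sub_distrib, ← Finset.sum_div]; simp
        _ ≤ n * (-(p / 2) + 1) := by linarith [hp f hf g hg hne]
        _ ≤ _ := by gcongr; exact Real.add_one_le_exp _
    rw [← Finset.mul_sum, e1]
    calc Real.exp (q * p / 4) * (∑ i, Real.exp (-D f g i)) ^ q
        ≤ Real.exp (q * p / 4) * (n * Real.exp (-(p / 2))) ^ q := by gcongr
      _ = n ^ q * Real.exp (-(q * p / 4)) := by
          rw [mul_pow, ← Real.exp_nat_mul, mul_left_comm, ← Real.exp_add]
          congr 2
          ring
      _ ≤ n ^ q * Real.exp (-(2 * Real.log A.card)) := by gcongr; linarith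
      _ = _ := by
          rw [Real.exp_neg, two_mul, Real.exp_add, Real.exp_log hA1, div_eq_mul_inv, sq]
  have h := low.trans (Finset.sum_le_card_nsmul _ _ _ up)
  rw [Finset.offDiag_card, nsmul_eq_mul, Nat.cast_sub (Nat.le_mul_self _)] at h
  push_cast at h
  have hpow : (0 : ℝ) < (n : ℝ) ^ q := by positivity
  have h2 : ((A.card : ℝ) * A.card - A.card) * ((n : ℝ) ^ q / (A.card : ℝ) ^ 2) =
      (n : ℝ) ^ q - (n : ℝ) ^ q / A.card := by field_simp
  rw [h2] at h
  have : 0 < (n : ℝ) ^ q / A.card := by positivity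
  linarith

/-- The number of partial functions with supports of size at most `d`. -/
lemma pow_mul_card_le_exp {q p d : ℕ} (S : Finset (Fin q → Option (Fin p)))
    (hS : ∀ c ∈ S, (Finset.univ.filter fun i => c i ≠ none).card ≤ d) {r : ℝ} (hr : 0 < r)
    (hr1 : r ≤ 1) : r ^ d * S.card ≤ Real.exp (r * p * q) := by
  classical
  -- Weighting a partial function by `r` to the size of its support makes the total weight factorize
  -- over coordinates.
  calc r ^ d * S.card = ∑ _c ∈ S, r ^ d := by
        rw [Finset.sum_const, nsmul_eq_mul, mul_comm]
    _ ≤ ∑ c ∈ S, ∏ i, (if c i ≠ none then r else 1) := by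
        refine Finset.sum_le_sum fun c hc => ?_
        rw [Finset.prod_ite]
        simp only [Finset.prod_const, one_pow, mul_one]
        exact pow_le_pow_of_le_one hr.le hr1 (hS c hc)
    _ ≤ ∑ c : Fin q → Option (Fin p), ∏ i, (if c i ≠ none then r else 1) := by
        refine Finset.sum_le_sum_of_subset_of_nonneg (Finset.subset_univ _) fun c _ _ => ?_
        exact Finset.prod_nonneg fun i _ => by split_ifs <;> positivity
    _ = (1 + p * r) ^ q := by
        have := Finset.prod_univ_sum (fun _ : Fin q => (Finset.univ : Finset (Option (Fin p))))
          (fun _ o => if o ≠ none then r else 1)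
        simp only [Fintype.piFinset_univ] at this
        rw [← this]
        simp [Fintype.sum_option]
    _ ≤ Real.exp (r * p) ^ q := by
        gcongr
        linarith [Real.add_one_le_exp (r * p)]
    _ = _ := by rw [← Real.exp_nat_mul]; congr 1; ring

/-- The support of a shattered cube is mapped injectively onto a shattered set. -/
lemma CubeShattered.exists_fatShatters {X ι κ : Type*} [Fintype ι] {y : ι → X} {lev : κ → ℝ}
    {γ M : ℝ} (hγ : 0 < γ) {B : Finset (X → ℝ)} {c : ι → Option κ}
    (hM : ∀ f ∈ B, ∀ x, f x ∈ Icc (-M) M) (h : CubeShattered y lev γ B c) :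
    ∃ A : Finset X, A.card = (Finset.univ.filter fun i => c i ≠ none).card ∧
      FatShatters (Icc (-M) M) γ (B : Set (X → ℝ)) A := by
  classical
  set I := Finset.univ.filter fun i => c i ≠ none with hI
  have hc : ∀ i ∈ I, ∃ v : ℝ, ∃ k, c i = some k ∧ v = lev k := fun i hi => by
    obtain ⟨k, hk⟩ := Option.ne_none_iff_exists'.1 (Finset.mem_filter.1 hi).2
    exact ⟨_, k, hk, rfl⟩
  choose! v hv using hc
  have hval : ∀ (l : ι → ℤˣ), ∃ f ∈ B, ∀ i ∈ I, γ ≤ ((l i : ℤ) : ℝ) * (f (y i) - v i) := by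
    intro l
    obtain ⟨f, hf, hf'⟩ := h l
    exact ⟨f, hf, fun i hi => by
      obtain ⟨k, hk, hvk⟩ := hv i hi
      rw [hvk]
      exact hf' i k hk⟩
  -- The points `y i` may repeat, but not on the support: opposite signs at two indices with the
  -- same point would force each of the two levels to exceed the other.
  have hinj : Set.InjOn y I := by
    intro i hi j hj hij
    by_contra hne
    obtain ⟨f, -, hf⟩ := hval (fun s => if s = i then 1 else -1)
    obtain ⟨g, -, hg⟩ := hval (fun s => if s = i then -1 else 1)
    have f1 := hf i hi
    have f2 := hf j hj
    have g1 := hg i hi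
    have g2 := hg j hj
    rw [if_pos rfl] at f1 g1
    rw [if_neg (Ne.symm hne)] at f2 g2
    push_cast at f1 f2 g1 g2
    rw [hij] at f1 g1
    linarith
  rcases isEmpty_or_nonempty ι with hι | hι
  · refine ⟨∅, by simp [hI], fun _ => 0, by simp, fun l => ?_⟩
    obtain ⟨f, hf, -⟩ := h isEmptyElim
    exact ⟨f, hf, by simp⟩
  refine ⟨I.image y, Finset.card_image_of_injOn hinj,
    fun t => v (Function.invFunOn y I t), ?_, fun l => ?_⟩
  · intro t ht
    obtain ⟨i, hi, rfl⟩ := Finset.mem_image.1 ht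
    simp only [hinj.leftInvOn_invFunOn (Finset.mem_coe.2 hi)]
    obtain ⟨f, hf, hf'⟩ := hval (fun _ => 1)
    obtain ⟨g, hg, hg'⟩ := hval (fun _ => -1)
    have f1 := hf' i hi
    have g1 := hg' i hi
    push_cast at f1 g1
    constructor <;> linarith [(hM f hf (y i)).2, (hM g hg (y i)).1]
  · obtain ⟨f, hf, hf'⟩ := hval (l ∘ y)
    refine ⟨f, hf, fun t ht => ?_⟩
    obtain ⟨i, hi, rfl⟩ := Finset.mem_image.1 ht
    simp only [hinj.leftInvOn_invFunOn (Finset.mem_coe.2 hi)]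
    exact hf' i hi

lemma FatShatters.mono {X : Type*} {S : Set ℝ} {γ γ' : ℝ} {F F' : Set (X → ℝ)} {A : Finset X}
    (h : FatShatters S γ F A) (hγ : γ' ≤ γ) (hF : F ⊆ F') : FatShatters S γ' F' A := by
  obtain ⟨b, hb, h⟩ := h
  refine ⟨b, hb, fun l => ?_⟩
  obtain ⟨f, hf, h⟩ := h l
  exact ⟨f, hF hf, fun t ht => hγ.trans (h t ht)⟩

/-- The levels `-M + k s` approximate the interval `[-M, M]`. -/
lemma exists_level {M s a : ℝ} (hs : 0 < s) (ha : a ∈ Icc (-M) M) :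
    ∃ k : Fin (⌊2 * M / s⌋₊ + 1), |(-M + (k : ℕ) * s) - a| ≤ s := by
  have h0 : 0 ≤ (a + M) / s := div_nonneg (by linarith [ha.1]) hs.le
  refine ⟨⟨⌊(a + M) / s⌋₊, Nat.lt_succ_of_le (Nat.floor_le_floor ?_)⟩, ?_⟩
  · gcongr
    linarith [ha.2]
  · have h1 := Nat.floor_le h0
    have h2 := Nat.lt_floor_add_one ((a + M) / s)
    rw [le_div_iff₀ hs] at h1
    rw [div_lt_iff₀ hs] at h2
    rw [abs_le]
    constructor <;> simp only <;> linarith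

/-- Packing numbers in empirical quadratic mean are bounded through the fat-shattering dimension. -/
theorem card_le_exp_of_separated {X : Type*} {n d : ℕ} (hn : 0 < n) (x : Fin n → X) {M ε : ℝ}
    (hM : 0 < M) (hε : 0 < ε) (hεM : ε ≤ 2 * M) (A : Finset (X → ℝ))
    (hA : ∀ f ∈ A, ∀ t, f t ∈ Icc (-M) M)
    (hd : ∀ T, FatShatters (Icc (-M) M) (ε / 96) (A : Set (X → ℝ)) T → T.card ≤ d)
    (hsep : ∀ f ∈ A, ∀ g ∈ A, f ≠ g → n * ε ^ 2 ≤ ∑ i, (f (x i) - g (x i)) ^ 2) :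
    (A.card : ℝ) ≤ Real.exp (20 * (d * Real.log (14 * M / ε))) := by
  have hlog : 0 ≤ Real.log (14 * M / ε) :=
    Real.log_nonneg (by rw [le_div_iff₀ hε]; linarith)
  rcases Nat.lt_or_ge A.card 2 with hN | hN
  · have : (A.card : ℝ) ≤ 1 := by exact_mod_cast Nat.lt_succ_iff.1 hN
    exact this.trans (Real.one_le_exp (by positivity))
  have hN2 : (2 : ℝ) ≤ A.card := by exact_mod_cast hN
  have hN0 : (0 : ℝ) < A.card := by linarith
  set Λ := Real.log A.card with hΛ
  -- This absorbs the rounding in `q`: `8 Λ + 1 ≤ 16 Λ`.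
  have hΛ2 : 1 / 2 < Λ :=
    lt_of_lt_of_le (by linarith [Real.log_two_gt_d9]) (Real.log_le_log (by norm_num) hN2)
  set t := (ε / (2 * M)) ^ 2 with ht
  have ht0 : 0 < t := by positivity
  have ht1 : t ≤ 1 := pow_le_one₀ (by positivity) (by rw [div_le_one (by positivity)]; exact hεM)
  set q := ⌈8 * Λ / t⌉₊ with hq
  have hq1 : 8 * Λ ≤ q * t := by
    have := Nat.le_ceil (8 * Λ / t)
    rwa [div_le_iff₀ ht0] at this
  have hq2 : q * t ≤ 16 * Λ := by
    have := Nat.ceil_lt_add_one (show 0 ≤ 8 * Λ / t by positivity)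
    have h2 : (q : ℝ) * t ≤ (8 * Λ / t + 1) * t := by gcongr
    rw [add_mul, div_mul_cancel₀ _ ht0.ne'] at h2
    linarith
  have hq0 : 0 < q := Nat.ceil_pos.2 (by positivity)
  have hq0' : (0 : ℝ) < q := by exact_mod_cast hq0
  obtain ⟨ω, hω⟩ := exists_subsample (q := q) (p := t) A (Finset.card_pos.1 (by omega))
    (fun f g i => ((f (x i) - g (x i)) / (2 * M)) ^ 2)
    (fun f hf g hg i => by
      refine ⟨sq_nonneg _, ?_⟩
      rw [sq_le_one_iff_abs_le_one, abs_div, abs_of_pos (show 0 < 2 * M by positivity),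
        div_le_one (by positivity), abs_le]
      have h1 := hA f hf (x i)
      have h2 := hA g hg (x i)
      constructor <;> linarith [h1.1, h1.2, h2.1, h2.2]) hn
    (fun f hf g hg hfg => by
      simp_rw [div_pow, ht, ← Finset.sum_div]
      rw [div_pow, ← mul_div_assoc]
      gcongr
      exact hsep f hf g hg hfg) hq1
  have : Nonempty (Fin q) := ⟨⟨0, hq0⟩⟩
  set p := ⌊2 * M / (ε / 32)⌋₊ + 1 with hp
  have hp0 : (0 : ℝ) < p := by positivity
  have hp1 : (p : ℝ) ≤ 66 * M / ε := by
    have h1 := Nat.floor_le (show 0 ≤ 2 * M / (ε / 32) by positivity)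
    have h2 : 2 * M / (ε / 32) = 64 * M / ε := by field_simp; norm_num
    have h3 : 1 ≤ 2 * M / ε := by rw [le_div_iff₀ hε]; linarith
    have h4 : 66 * M / ε = 64 * M / ε + 2 * M / ε := by ring
    rw [hp]
    push_cast
    rw [h4, ← h2]
    linarith
  -- The subsample keeps a quarter of the squared distances, so `τ = ε / 2`. Then `96 (ε / 24)² = ε²
  -- / 6 < τ²`, and the mesh is `δ - γ = ε / 24 - ε / 96 = ε / 32`.
  have hroot := sqrt_card_le_card_shatteredCubes (x ∘ ω) (fun k : Fin p => -M + (k : ℕ) * (ε / 32))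
    (M := M) (γ := ε / 96) (δ := ε / 24) (τ := ε / 2) (by positivity) (by positivity)
    (by nlinarith [sq_pos_of_pos hε])
    (fun a ha => by
      obtain ⟨k, hk⟩ := exists_level (s := ε / 32) (by positivity) ha
      exact ⟨k, hk.trans (by linarith)⟩) A hA
    (fun f hf g hg hfg => by
      have h := hω f hf g hg hfg
      simp_rw [div_pow, ht, ← Finset.sum_div] at h
      rw [div_pow, le_div_iff₀ (by positivity)] at h
      rw [Fintype.card_fin]
      refine le_trans (le_of_eq ?_) h
      field_simp
      norm_num)
  -- With this weight the total is at most `#A ^ (1/4)`; against the lower bound `√#A` there remains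
  -- `Λ / 4 ≤ d log (1 / r)`.
  set r := t / (64 * p) with hr
  have hr0 : 0 < r := by positivity
  have hr1 : r ≤ 1 := by
    rw [hr, div_le_one (by positivity)]
    have : (1 : ℝ) ≤ p := by rw [hp]; push_cast; linarith [Nat.cast_nonneg (α := ℝ) ⌊2 * M / (ε / 32)⌋₊]
    linarith
  have hcount := pow_mul_card_le_exp (d := d)
    (shatteredCubes (x ∘ ω) (fun k : Fin p => -M + (k : ℕ) * (ε / 32)) (ε / 96) A)
    (fun c hc => by
      obtain ⟨T, hT, hT'⟩ := (mem_shatteredCubes.1 hc).exists_fatShatters (by positivity) hA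
      rw [← hT]
      exact hd T hT') hr0 hr1
  have hexp : r * p * q ≤ Λ / 4 := by
    have : r * p * q = q * t / 64 := by rw [hr]; field_simp
    rw [this]
    linarith
  have h1 : r ^ d * √(A.card : ℝ) ≤ Real.exp (Λ / 4) :=
    (mul_le_mul_of_nonneg_left hroot (by positivity)).trans
      (hcount.trans (Real.exp_le_exp.2 hexp))
  have h2 := Real.log_le_log (by positivity) h1
  rw [Real.log_exp, Real.log_mul (by positivity) (by positivity), Real.log_pow,
    Real.log_sqrt hN0.le] at h2
  -- `1 / r` is at most a multiple of `(M / ε) ^ 3`; since `M / ε ≥ 1 / 2`, a fifth power of `14 M /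
  -- ε` also absorbs the constant. Then 20 = 4 · 5.
  have h3 : -Real.log r ≤ 5 * Real.log (14 * M / ε) := by
    rw [← Real.log_inv, show (5 : ℝ) = ((5 : ℕ) : ℝ) by norm_num, ← Real.log_pow]
    apply Real.log_le_log (by positivity)
    have e1 : r⁻¹ = 64 * p / t := by rw [hr, inv_div]
    have e2 : 64 * p / t ≤ 64 * (66 * M / ε) / t := by gcongr
    have e3 : 64 * (66 * M / ε) / t = 16896 * (M / ε) ^ 3 := by rw [ht]; field_simp; norm_num
    have e4 : (14 * M / ε) ^ 5 = 537824 * ((M / ε) ^ 3 * (M / ε) ^ 2) := by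
      rw [mul_div_assoc]; ring
    have e5 : 1 / 4 ≤ (M / ε) ^ 2 := by
      have : 1 / 2 ≤ M / ε := by rw [le_div_iff₀ hε]; linarith
      nlinarith
    rw [e1, e4]
    refine e2.trans (e3.le.trans ?_)
    have e6 : 0 < (M / ε) ^ 3 := by positivity
    nlinarith
  have h4 : Λ ≤ 20 * (d * Real.log (14 * M / ε)) := by
    have := mul_le_mul_of_nonneg_left h3 (Nat.cast_nonneg (α := ℝ) d)
    linarith
  calc (A.card : ℝ) = Real.exp Λ := (Real.exp_log hN0).symm
    _ ≤ _ := Real.exp_le_exp.2 h4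

/-! ### Finiteness of the fat-shattering dimension of uniform Glivenko-Cantelli classes -/

lemma FatShatters.card_le_fatDim {T : Type*} {S : Set ℝ} {γ : ℝ} {F : Set (T → ℝ)} {A : Finset T}
    (h : FatShatters S γ F A) : (A.card : ℕ∞) ≤ fatDim S γ F :=
  le_iSup₂ (f := fun (A : Finset T) (_ : FatShatters S γ F A) => (A.card : ℕ∞)) A h

lemma fatDim_anti {T : Type*} (S : Set ℝ) (F : Set (T → ℝ)) : Antitone fun γ => fatDim S γ F :=
  fun _ _ h => iSup₂_le fun _ hA => (hA.mono h subset_rfl).card_le_fatDim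

lemma exists_fatShatters_of_fatDim_eq_top {T : Type*} {S : Set ℝ} {γ : ℝ} {F : Set (T → ℝ)}
    (h : fatDim S γ F = ⊤) (n : ℕ) : ∃ A, n ≤ A.card ∧ FatShatters S γ F A := by
  by_contra hcon
  push Not at hcon
  have : fatDim S γ F ≤ n := iSup₂_le fun A hA => by
    by_contra hlt
    exact hcon A (by exact_mod_cast (not_le.1 hlt).le) hA
  rw [h] at this
  simp at this

lemma integral_map_uniformOfFintype {X : Type*} [MeasurableSpace X] {N : ℕ} [NeZero N]
    (φ : Fin N → X) {f : X → ℝ} (hf : Measurable f) :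
    ∫ t, f t ∂(Measure.map φ (PMF.uniformOfFintype (Fin N)).toMeasure) =
      (N : ℝ)⁻¹ * ∑ a, f (φ a) := by
  rw [integral_map (measurable_of_finite φ).aemeasurable hf.aestronglyMeasurable,
    PMF.integral_eq_sum, Finset.mul_sum]
  simp

/-- A large shattered set carries a law for which every sample of size `n` has a large deviation. -/
lemma exists_measure_deviation_eq_one {X : Type*} [MeasurableSpace X] {F : Set (X → ℝ)} {M ε : ℝ}
    (hF : ∀ f ∈ F, Measurable f) (hFM : ∀ f ∈ F, ∀ x, f x ∈ Icc (-M) M) (hε : 0 < ε) (hM : 0 < M)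
    {S : Set ℝ} (htop : fatDim S ε F = ⊤) {n : ℕ} (hn : 0 < n) :
    ∃ P : ProbabilityMeasure X, 1 ≤ Measure.infinitePi (fun _ : ℕ => (P : Measure X))
          {ω : ℕ → X | ∃ n' : ℕ, n ≤ n' ∧ ∃ f ∈ F,
            ε / 3 < |(n' : ℝ)⁻¹ * ∑ i ∈ Finset.range n', f (ω i) -
              ∫ t, f t ∂(P : Measure X)|} := by
  classical
  obtain ⟨A, hAn, b, -, hA⟩ := exists_fatShatters_of_fatDim_eq_top htop (⌈n * (2 * M) / ε⌉₊ + 1)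
  have hA1 : n * (2 * M) / ε ≤ A.card :=
    (Nat.le_ceil _).trans (by exact_mod_cast (Nat.le_succ _).trans hAn)
  rw [div_le_iff₀ hε] at hA1
  have hN : A.card ≠ 0 := by omega
  set N := A.card with hNdef
  have : NeZero N := ⟨hN⟩
  have hN0 : (0 : ℝ) < N := by positivity
  have hn0 : (0 : ℝ) < n := by exact_mod_cast hn
  set φ : Fin N → X := fun a => (A.equivFin.symm a : X) with hφ
  have hφA : ∀ a, φ a ∈ A := fun a => (A.equivFin.symm a).2
  have hφinj : Function.Injective φ := Subtype.val_injective.comp A.equivFin.symm.injective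
  have hφm : Measurable φ := measurable_of_finite φ
  have hφpi : Measurable fun (ω : ℕ → Fin N) i => φ (ω i) :=
    measurable_pi_lambda _ fun i => hφm.comp (measurable_pi_apply i)
  set U := (PMF.uniformOfFintype (Fin N)).toMeasure
  have : IsProbabilityMeasure (Measure.map φ U) :=
    Measure.isProbabilityMeasure_map hφm.aemeasurable
  refine ⟨⟨Measure.map φ U, inferInstance⟩, ?_⟩
  rw [ProbabilityMeasure.coe_mk, ← Measure.infinitePi_map_pi (fun _ : ℕ => U) fun _ => hφm]
  -- Pulled back to sequences in `Fin N`, the event contains every `ω`. This inequality needs no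
  -- measurability of the event.
  refine le_trans ?_ (Measure.le_map_apply hφpi.aemeasurable _)
  rw [← measure_univ (μ := Measure.infinitePi fun _ : ℕ => U)]
  refine measure_mono fun ω _ => ?_
  simp only [mem_preimage, mem_ofPred_eq]
  refine ⟨n, le_rfl, ?_⟩
  by_contra hcon
  push Not at hcon
  -- Take `f` high on the sample and low off it, and `g` the reverse. Their empirical means differ
  -- by at least `2 ε`, but their integrals by at most `2 M n / N ≤ ε`, so one of the two deviates
  -- by more than `ε / 3`.
  set I := (Finset.range n).image fun i => φ (ω i)
  have hI : I.card ≤ n := Finset.card_image_le.trans (by simp)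
  obtain ⟨f, hf, hf'⟩ := hA fun t => if t ∈ I then 1 else -1
  obtain ⟨g, hg, hg'⟩ := hA fun t => if t ∈ I then -1 else 1
  have hin : ∀ t ∈ A, t ∈ I → 2 * ε ≤ f t - g t := by
    intro t ht hti
    have h1 := hf' t ht
    have h2 := hg' t ht
    rw [if_pos hti] at h1 h2
    push_cast at h1 h2
    linarith
  have hout : ∀ t ∈ A, t ∉ I → f t - g t ≤ 0 := by
    intro t ht hti
    have h1 := hf' t ht
    have h2 := hg' t ht
    rw [if_neg hti] at h1 h2
    push_cast at h1 h2
    linarith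
  have h1 := hcon f hf
  have h2 := hcon g hg
  rw [integral_map_uniformOfFintype φ (hF f hf)] at h1
  rw [integral_map_uniformOfFintype φ (hF g hg)] at h2
  have emp : 2 * ε ≤ (n : ℝ)⁻¹ * ∑ i ∈ Finset.range n, f (φ (ω i)) -
      (n : ℝ)⁻¹ * ∑ i ∈ Finset.range n, g (φ (ω i)) := by
    rw [← mul_sub, ← Finset.sum_sub_distrib, inv_mul_eq_div, le_div_iff₀ hn0, mul_comm]
    have := Finset.card_nsmul_le_sum (Finset.range n) (fun i => f (φ (ω i)) - g (φ (ω i))) (2 * ε)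
      fun i hi => hin _ (hφA _) (Finset.mem_image_of_mem _ hi)
    simpa using this
  have mean : (N : ℝ)⁻¹ * ∑ a, f (φ a) - (N : ℝ)⁻¹ * ∑ a, g (φ a) ≤ ε := by
    rw [← mul_sub, ← Finset.sum_sub_distrib, inv_mul_eq_div, div_le_iff₀ hN0]
    calc ∑ a, (f (φ a) - g (φ a)) ≤ ∑ a, (if φ a ∈ I then 2 * M else 0) := by
          refine Finset.sum_le_sum fun a _ => ?_
          split_ifs with h
          · linarith [(hFM f hf (φ a)).2, (hFM g hg (φ a)).1]
          · exact hout _ (hφA a) h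
      _ = ((Finset.univ.filter fun a => φ a ∈ I).card : ℝ) * (2 * M) := by
          rw [← Finset.sum_filter, Finset.sum_const, nsmul_eq_mul]
      _ ≤ n * (2 * M) := by
          gcongr
          refine le_trans ?_ hI
          exact Finset.card_le_card_of_injOn φ (fun a ha => (Finset.mem_filter.1 ha).2)
            hφinj.injOn
      _ ≤ _ := by linarith
  rw [abs_le] at h1 h2
  linarith [h1.1, h1.2, h2.1, h2.2]

/-- The fat-shattering dimensions of a uniformly bounded uniform Glivenko-Cantelli class are
finite. -/
lemma IsUniformGC.fatDim_ne_top {X : Type*} [MeasurableSpace X] {F : Set (X → ℝ)}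
    (hF : IsUniformGC F) {M : ℝ} (hM : 0 < M) (hFM : ∀ f ∈ F, ∀ x, f x ∈ Icc (-M) M) (S : Set ℝ)
    {ε : ℝ} (hε : 0 < ε) : fatDim S ε F ≠ ⊤ := by
  intro htop
  have h := (hF.2 (ε / 3) (by positivity)).eventually (gt_mem_nhds (zero_lt_one (α := ENNReal)))
  obtain ⟨n, hn, hn1⟩ := (h.and (eventually_ge_atTop 1)).exists
  obtain ⟨P, hP⟩ := exists_measure_deviation_eq_one hF.1 hFM hε hM htop hn1
  refine absurd hn (not_lt.2 (hP.trans ?_))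
  exact le_iSup (fun P : ProbabilityMeasure X => Measure.infinitePi (fun _ : ℕ => (P : Measure X))
          {ω : ℕ → X | ∃ n' : ℕ, n ≤ n' ∧ ∃ f ∈ F,
            ε / 3 < |(n' : ℝ)⁻¹ * ∑ i ∈ Finset.range n', f (ω i) -
              ∫ t, f t ∂(P : Measure X)|}) P

lemma maxFatDim_ne_top {X : Type*} [MeasurableSpace X] {C : ℕ} (hC : 0 < C) {M : ℝ} (hM : 0 < M)
    {G : Fin C → Set (X → ℝ)} (hGM : ∀ k, ∀ g ∈ G k, ∀ x, g x ∈ Icc (-M) M)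
    (hGC : ∀ k, IsUniformGC (G k)) {ε : ℝ} (hε : 0 < ε) : maxFatDim M G ε ≠ ⊤ := by
  have : Nonempty (Fin C) := ⟨⟨0, hC⟩⟩
  obtain ⟨k, hk⟩ := exists_eq_ciSup_of_finite (f := fun k => fatDim (Icc (-M) M) ε (G k))
  rw [maxFatDim, ← hk]
  exact (hGC k).fatDim_ne_top hM (hGM k) _ hε

lemma maxFatDim_anti {X : Type*} {C : ℕ} (M : ℝ) (G : Fin C → Set (X → ℝ)) :
    Antitone (maxFatDim M G) :=
  fun _ _ h => iSup_mono fun k => fatDim_anti _ (G k) h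

lemma fatDim_le_maxFatDim {X : Type*} {C : ℕ} (M : ℝ) (G : Fin C → Set (X → ℝ)) (ε : ℝ)
    (k : Fin C) : fatDim (Icc (-M) M) ε (G k) ≤ maxFatDim M G ε :=
  le_iSup (fun k => fatDim (Icc (-M) M) ε (G k)) k

/-! ### Nets of the component classes and of the squashed margin class -/

section Nets

/-- A class of bounded functions has internal nets, in empirical quadratic mean, whose sizes are
bounded through the fat-shattering dimension. -/
lemma exists_net {X : Type*} {n d : ℕ} (hn : 0 < n) (x : Fin n → X) {M ε : ℝ} (hM : 0 < M)
    (hε : 0 < ε) (hεM : ε ≤ 2 * M) {F : Set (X → ℝ)} (hF : ∀ f ∈ F, ∀ t, f t ∈ Icc (-M) M)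
    (hd : fatDim (Icc (-M) M) (ε / 96) F ≤ d) :
    ∃ V : Finset (X → ℝ), (V : Set (X → ℝ)) ⊆ F ∧
      (V.card : ℝ) ≤ Real.exp (20 * (d * Real.log (14 * M / ε))) ∧
      ∀ f ∈ F, ∃ v ∈ V, ∑ i, (f (x i) - v (x i)) ^ 2 ≤ n * ε ^ 2 := by
  classical
  let Sep : Finset (X → ℝ) → Prop := fun A => (A : Set (X → ℝ)) ⊆ F ∧
    ∀ f ∈ A, ∀ g ∈ A, f ≠ g → n * ε ^ 2 ≤ ∑ i, (f (x i) - g (x i)) ^ 2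
  have hcard : ∀ A, Sep A → (A.card : ℝ) ≤ Real.exp (20 * (d * Real.log (14 * M / ε))) := by
    intro A hA
    refine card_le_exp_of_separated hn x hM hε hεM A (fun f hf => hF f (hA.1 hf)) ?_ hA.2
    intro T hT
    exact_mod_cast (hT.mono le_rfl hA.1).card_le_fatDim.trans hd
  -- The packing bound provides a separated set of greatest cardinality, which is a net: a function
  -- far from it could be added.
  set K := ⌊Real.exp (20 * (d * Real.log (14 * M / ε)))⌋₊
  have hcard' : ∀ A, Sep A → A.card ≤ K := fun A hA => Nat.le_floor (hcard A hA)
  let Q : ℕ → Prop := fun k => ∃ A, Sep A ∧ A.card = k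
  have hQ0 : Q 0 := ⟨∅, ⟨by simp, by simp⟩, rfl⟩
  obtain ⟨V, hV, hVc⟩ := Nat.findGreatest_spec (Nat.zero_le K) hQ0
  refine ⟨V, hV.1, hcard V hV, fun f hf => ?_⟩
  by_contra hcon
  push Not at hcon
  have hfV : f ∉ V := fun hfV => by
    have := hcon f hfV
    simp only [sub_self, ne_eq, OfNat.ofNat_ne_zero, not_false_eq_true, zero_pow,
      Finset.sum_const_zero] at this
    exact absurd this (not_lt.2 (by positivity))
  have hins : Sep (insert f V) := by
    refine ⟨?_, fun g hg g' hg' hne => ?_⟩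
    · rw [Finset.coe_insert]
      exact insert_subset hf hV.1
    · rcases Finset.mem_insert.1 hg with rfl | hg1 <;>
        rcases Finset.mem_insert.1 hg' with rfl | hg1'
      · exact absurd rfl hne
      · exact (hcon g' hg1').le
      · refine (hcon g hg1).le.trans (le_of_eq ?_)
        exact Finset.sum_congr rfl fun i _ => by ring
      · exact hV.2 g hg1 g' hg1' hne
  have h1 := Nat.le_findGreatest (P := Q) (hcard' _ hins) ⟨_, hins, rfl⟩
  rw [Finset.card_insert_of_notMem hfV] at h1
  omega

lemma squash_eq_max_min {γ : ℝ} (hγ : 0 < γ) (t : ℝ) : squash γ t = max 0 (min t γ) := by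
  unfold squash
  by_cases h1 : t ≤ γ
  · rw [indicator_of_notMem (s := Ioi γ) (by simpa using h1), add_zero, min_eq_left h1]
    by_cases h0 : 0 < t
    · rw [indicator_of_mem (show t ∈ Ioc 0 γ from ⟨h0, h1⟩), max_eq_right h0.le]
    · rw [indicator_of_notMem (fun h => h0 h.1), max_eq_left (not_lt.1 h0)]
  · push Not at h1
    rw [indicator_of_notMem (fun h => absurd h.2 (not_le.2 h1)),
      indicator_of_mem (show t ∈ Ioi γ from h1), zero_add, min_eq_right h1.le, max_eq_right hγ.le]

lemma squash_mem_Icc {γ : ℝ} (hγ : 0 < γ) (t : ℝ) : squash γ t ∈ Icc 0 γ := by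
  rw [squash_eq_max_min hγ]
  exact ⟨le_max_left _ _, max_le hγ.le (min_le_right _ _)⟩

lemma abs_squash_sub_le {γ : ℝ} (hγ : 0 < γ) (s t : ℝ) : |squash γ s - squash γ t| ≤ |s - t| := by
  rw [squash_eq_max_min hγ, squash_eq_max_min hγ]
  refine (abs_max_sub_max_le_max _ _ _ _).trans (max_le (by simp) ?_)
  exact (abs_min_sub_min_le_max _ _ _ _).trans (max_le le_rfl (by simp))

lemma iSup_sub_iSup_le {ι : Type*} [Finite ι] {a b : ι → ℝ} {D : ℝ} (hD : 0 ≤ D)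
    (h : ∀ i, a i - b i ≤ D) : (⨆ i, a i) - ⨆ i, b i ≤ D := by
  -- Over an empty index type both real suprema are 0, hence the assumption `hD`.
  rcases isEmpty_or_nonempty ι with hι | hι
  · simpa [Real.iSup_of_isEmpty] using hD
  rw [sub_le_iff_le_add]
  exact ciSup_le fun i => by linarith [h i, le_ciSup (Set.finite_range b).bddAbove i]

lemma abs_marginFun_sub_le {X : Type*} {C : ℕ} (g g' : Fin C → X → ℝ) (z : X × Fin C) {D : ℝ}
    (h : ∀ k, |g k z.1 - g' k z.1| ≤ D) : |marginFun g z - marginFun g' z| ≤ D := by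
  have hD : 0 ≤ D := (abs_nonneg _).trans (h z.2)
  have h1 := iSup_sub_iSup_le (a := fun l : {l : Fin C // l ≠ z.2} => g l.1 z.1)
    (b := fun l => g' l.1 z.1) hD fun l => (abs_le.1 (h l)).2
  have h2 := iSup_sub_iSup_le (a := fun l : {l : Fin C // l ≠ z.2} => g' l.1 z.1)
    (b := fun l => g l.1 z.1) hD fun l => by linarith [(abs_le.1 (h l)).1]
  have h3 := abs_le.1 (h z.2)
  unfold marginFun
  rw [abs_le]
  constructor <;> linarith [h3.1, h3.2]

lemma sq_squash_marginFun_sub_le {X : Type*} {C : ℕ} {γ : ℝ} (hγ : 0 < γ) (g g' : Fin C → X → ℝ)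
    (z : X × Fin C) :
    (squash γ (marginFun g z) - squash γ (marginFun g' z)) ^ 2 ≤
      ∑ k, (g k z.1 - g' k z.1) ^ 2 := by
  have h0 : 0 ≤ ∑ k, (g k z.1 - g' k z.1) ^ 2 := Finset.sum_nonneg fun k _ => sq_nonneg _
  rw [← Real.sq_sqrt h0]
  apply sq_le_sq'
  all_goals
    have h1 := (abs_squash_sub_le hγ (marginFun g z) (marginFun g' z)).trans
      (abs_marginFun_sub_le g g' z (D := √(∑ k, (g k z.1 - g' k z.1) ^ 2)) fun k =>
        Real.abs_le_sqrt (Finset.single_le_sum (f := fun k => (g k z.1 - g' k z.1) ^ 2)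
          (fun k _ => sq_nonneg _) (Finset.mem_univ k)))
    linarith [(abs_le.1 h1).1, (abs_le.1 h1).2]

/-- A product of nets at scale `ε / √C`: the squared errors of the `C` components add up to `ε²`,
and the exponents of their sizes add up to the factor `C`. -/
lemma exists_net_squashedMarginClass {X : Type*} {C m d : ℕ} (hC : 0 < C) (hm : 0 < m)
    (z : Fin m → X × Fin C) {M ε γ : ℝ} (hM : 0 < M) (hγ : 0 < γ) (hε : 0 < ε)
    (hεM : ε ≤ 2 * M * √(C : ℝ)) {G : Fin C → Set (X → ℝ)}
    (hG : ∀ k, ∀ g ∈ G k, ∀ x, g x ∈ Icc (-M) M) (hd : maxFatDim M G (ε / (96 * √(C : ℝ))) ≤ d) :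
    ∃ V : Finset (X × Fin C → ℝ),
      (V.card : ℝ) ≤ Real.exp (20 * C * (d * Real.log (14 * M * √(C : ℝ) / ε))) ∧
      ∀ f ∈ squashedMarginClass G γ, ∃ v ∈ V, ∑ i, (f (z i) - v (z i)) ^ 2 ≤ m * ε ^ 2 := by
  classical
  have hC0 : (0 : ℝ) < C := by exact_mod_cast hC
  have hs : 0 < √(C : ℝ) := Real.sqrt_pos.2 hC0
  have hnet := fun k => exists_net (x := fun i => (z i).1) (d := d) hm hM (ε := ε / √(C : ℝ))
    (by positivity) (by rwa [div_le_iff₀ hs]) (hG k) (by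
      rw [div_div, mul_comm (√(C : ℝ))]
      exact (fatDim_le_maxFatDim M G _ k).trans hd)
  choose V hVG hVc hV using hnet
  refine ⟨(Fintype.piFinset V).image fun g z => squash γ (marginFun g z), ?_, ?_⟩
  · calc _ ≤ ((Fintype.piFinset V).card : ℝ) := by exact_mod_cast Finset.card_image_le
      _ = ∏ k, ((V k).card : ℝ) := by rw [Fintype.card_piFinset]; push_cast; rfl
      _ ≤ ∏ _k : Fin C, Real.exp (20 * (d * Real.log (14 * M / (ε / √(C : ℝ))))) :=
          Finset.prod_le_prod (fun _ _ => by positivity) fun k _ => hVc k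
      _ = _ := by
          rw [Finset.prod_const, ← Real.exp_nat_mul, Finset.card_univ, Fintype.card_fin,
            div_div_eq_mul_div]
          congr 1
          ring
  · rintro f ⟨g, hg, rfl⟩
    choose v hv hv' using fun k => hV k (g k) (hg k)
    refine ⟨_, Finset.mem_image_of_mem _ (Fintype.mem_piFinset.2 hv), ?_⟩
    calc _ ≤ ∑ i, ∑ k, (g k (z i).1 - v k (z i).1) ^ 2 :=
          Finset.sum_le_sum fun i _ => sq_squash_marginFun_sub_le hγ g v (z i)
      _ = ∑ k, ∑ i, (g k (z i).1 - v k (z i).1) ^ 2 := Finset.sum_comm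
      _ ≤ ∑ _k : Fin C, m * (ε / √(C : ℝ)) ^ 2 := Finset.sum_le_sum fun k _ => hv' k
      _ = _ := by
          rw [Finset.sum_const, Finset.card_univ, Fintype.card_fin, nsmul_eq_mul, div_pow,
            Real.sq_sqrt hC0.le]
          field_simp

end Nets

/-! ### Massart's lemma and chaining for a fixed sample -/

section Chaining

variable {T : Type*} {n : ℕ}

lemma sum_prod_exp_sign (c : Fin n → ℝ) :
    ∑ σ : Fin n → ℤˣ, ∏ i, Real.exp (((σ i : ℤ) : ℝ) * c i) = 2 ^ n * ∏ i, Real.cosh (c i) := by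
  have := Finset.prod_univ_sum (fun _ : Fin n => (Finset.univ : Finset ℤˣ))
    (fun i u => Real.exp (((u : ℤ) : ℝ) * c i))
  simp only [Fintype.piFinset_univ] at this
  rw [← this]
  have h : ∀ i, ∑ u : ℤˣ, Real.exp (((u : ℤ) : ℝ) * c i) = 2 * Real.cosh (c i) := fun i => by
    rw [Real.cosh_eq, show (Finset.univ : Finset ℤˣ) = {1, -1} from rfl,
      Finset.sum_pair (by decide)]
    push_cast
    rw [one_mul, neg_one_mul]
    ring
  simp_rw [h]
  rw [Finset.prod_mul_distrib]
  simp

/-- The finite class lemma of Massart. -/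
lemma signMeanMax_le_of_card (hn : 0 < n) (W : Finset (T → ℝ)) (hW : W.Nonempty) (t : Fin n → T)
    {r Λ : ℝ} (hr : 0 < r) (hcard : (W.card : ℝ) ≤ Real.exp Λ)
    (hnorm : ∀ w ∈ W, ∑ i, w (t i) ^ 2 ≤ n * r ^ 2) :
    signMeanMax W hW t ≤ r * √(2 * Λ / n) := by
  have hn0 : (0 : ℝ) < n := by exact_mod_cast hn
  set E := signMeanMax W hW t with hE
  have key : ∀ s : ℝ, 0 < s → s * E ≤ Λ + s ^ 2 * r ^ 2 / (2 * n) := by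
    intro s hs
    rw [← Real.exp_le_exp, Real.exp_add]
    have jensen := convexOn_exp.map_sum_le (t := (Finset.univ : Finset (Fin n → ℤˣ)))
      (w := fun _ => ((2 : ℝ) ^ n)⁻¹)
      (p := fun σ => s * W.sup' hW (fun f => (n : ℝ)⁻¹ * ∑ i, ((σ i : ℤ) : ℝ) * f (t i)))
      (fun _ _ => by positivity) (by simp [Finset.card_univ]) (fun _ _ => mem_univ _)
    simp only [smul_eq_mul] at jensen
    calc Real.exp (s * E) ≤ ∑ σ : Fin n → ℤˣ, ((2 : ℝ) ^ n)⁻¹ *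
          Real.exp (s * W.sup' hW (fun f => (n : ℝ)⁻¹ * ∑ i, ((σ i : ℤ) : ℝ) * f (t i))) := by
          refine le_trans (le_of_eq ?_) jensen
          rw [hE, signMeanMax, Finset.mul_sum, Finset.mul_sum]
          congr 1
          exact Finset.sum_congr rfl fun σ _ => by ring
      _ ≤ ∑ σ : Fin n → ℤˣ, ((2 : ℝ) ^ n)⁻¹ *
          ∑ f ∈ W, ∏ i, Real.exp (((σ i : ℤ) : ℝ) * (s * f (t i) / n)) := by
          gcongr with σ _
          obtain ⟨f, hf, hf'⟩ := Finset.exists_mem_eq_sup' hW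
            (fun f => (n : ℝ)⁻¹ * ∑ i, ((σ i : ℤ) : ℝ) * f (t i))
          rw [hf']
          refine le_trans (le_of_eq ?_) (Finset.single_le_sum (f := fun f : T → ℝ =>
            ∏ i, Real.exp (((σ i : ℤ) : ℝ) * (s * f (t i) / n))) (fun f _ => by positivity) hf)
          rw [← Real.exp_sum, Finset.mul_sum, Finset.mul_sum]
          congr 1
          exact Finset.sum_congr rfl fun i _ => by field_simp
      _ = ∑ f ∈ W, ∏ i, Real.cosh (s * f (t i) / n) := by
          rw [← Finset.mul_sum, Finset.sum_comm]
          simp_rw [sum_prod_exp_sign]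
          rw [← Finset.mul_sum, inv_mul_cancel_left₀ (by positivity)]
      _ ≤ ∑ _f ∈ W, Real.exp (s ^ 2 * r ^ 2 / (2 * n)) := by
          refine Finset.sum_le_sum fun f hf => ?_
          calc ∏ i, Real.cosh (s * f (t i) / n)
              ≤ ∏ i, Real.exp ((s * f (t i) / n) ^ 2 / 2) :=
                Finset.prod_le_prod (fun i _ => (Real.cosh_pos _).le)
                  fun i _ => Real.cosh_le_exp_half_sq _
            _ = Real.exp (s ^ 2 / (2 * n ^ 2) * ∑ i, f (t i) ^ 2) := by
                rw [← Real.exp_sum, Finset.mul_sum]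
                congr 1
                exact Finset.sum_congr rfl fun i _ => by field_simp
            _ ≤ Real.exp (s ^ 2 / (2 * n ^ 2) * (n * r ^ 2)) := by
                gcongr
                exact hnorm f hf
            _ = _ := by congr 1; field_simp
      _ = W.card * Real.exp (s ^ 2 * r ^ 2 / (2 * n)) := by rw [Finset.sum_const, nsmul_eq_mul]
      _ ≤ _ := by gcongr
  have hΛ : 0 ≤ Λ := by
    rw [← Real.one_le_exp_iff]
    refine le_trans ?_ hcard
    exact_mod_cast Finset.card_pos.2 hW
  by_contra hcon
  push Not at hcon
  have h0 : 0 ≤ r * √(2 * Λ / n) := by positivity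
  have hE0 : 0 < E := lt_of_le_of_lt h0 hcon
  -- This `s` maximizes `s E - s² r² / (2 n)`.
  have h1 := key (n * E / r ^ 2) (by positivity)
  have h2 : (r * √(2 * Λ / n)) ^ 2 < E ^ 2 := by gcongr
  rw [mul_pow, Real.sq_sqrt (by positivity)] at h2
  have e1 : n * E / r ^ 2 * E = n * E ^ 2 / r ^ 2 := by ring
  have e2 : (n * E / r ^ 2) ^ 2 * r ^ 2 / (2 * n) = n * E ^ 2 / r ^ 2 / 2 := by field_simp
  rw [e1, e2] at h1
  have h3 : n * E ^ 2 / r ^ 2 ≤ 2 * Λ := by linarith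
  rw [div_le_iff₀ (by positivity)] at h3
  have h4 : r ^ 2 * (2 * Λ / n) = 2 * Λ * r ^ 2 / n := by ring
  rw [h4, div_lt_iff₀ hn0] at h2
  linarith

/-- The triangle inequality in quadratic mean, free of square roots: Young's inequality with weights
`b / a` and `a / b`. -/
lemma sum_sq_sub_le_of_le {u v w : Fin n → ℝ} {a b c : ℝ} (ha : 0 < a) (hb : 0 < b)
    (hv : ∑ i, (u i - v i) ^ 2 ≤ c * a ^ 2) (hw : ∑ i, (u i - w i) ^ 2 ≤ c * b ^ 2) :
    ∑ i, (v i - w i) ^ 2 ≤ c * (a + b) ^ 2 := by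
  have h : ∀ i, (v i - w i) ^ 2 ≤ (1 + b / a) * (u i - v i) ^ 2 + (1 + a / b) * (u i - w i) ^ 2 := by
    intro i
    have : (1 + b / a) * (u i - v i) ^ 2 + (1 + a / b) * (u i - w i) ^ 2 - (v i - w i) ^ 2 =
        (b * (u i - v i) + a * (u i - w i)) ^ 2 / (a * b) := by
      field_simp
      ring
    have h2 : 0 ≤ (b * (u i - v i) + a * (u i - w i)) ^ 2 / (a * b) := by positivity
    linarith
  calc ∑ i, (v i - w i) ^ 2
      ≤ ∑ i, ((1 + b / a) * (u i - v i) ^ 2 + (1 + a / b) * (u i - w i) ^ 2) :=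
        Finset.sum_le_sum fun i _ => h i
    _ = (1 + b / a) * ∑ i, (u i - v i) ^ 2 + (1 + a / b) * ∑ i, (u i - w i) ^ 2 := by
        rw [Finset.sum_add_distrib, Finset.mul_sum, Finset.mul_sum]
    _ ≤ (1 + b / a) * (c * a ^ 2) + (1 + a / b) * (c * b ^ 2) := by gcongr
    _ = _ := by field_simp; ring

lemma mean_sign_mul_le (hn : 0 < n) (σ : Fin n → ℤˣ) {a : Fin n → ℝ} {r : ℝ} (hr : 0 ≤ r)
    (ha : ∑ i, a i ^ 2 ≤ n * r ^ 2) : (n : ℝ)⁻¹ * ∑ i, ((σ i : ℤ) : ℝ) * a i ≤ r := by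
  have hn0 : (0 : ℝ) < n := by exact_mod_cast hn
  rw [inv_mul_eq_div, div_le_iff₀ hn0]
  apply le_of_sq_le_sq _ (by positivity)
  calc (∑ i, ((σ i : ℤ) : ℝ) * a i) ^ 2 ≤ n * ∑ i, (((σ i : ℤ) : ℝ) * a i) ^ 2 := by
        simpa using sq_sum_le_card_mul_sum_sq (s := Finset.univ)
          (f := fun i => ((σ i : ℤ) : ℝ) * a i)
    _ = n * ∑ i, a i ^ 2 := by
        congr 1
        refine Finset.sum_congr rfl fun i _ => ?_
        rcases Int.units_eq_one_or (σ i) with h | h <;> simp [h]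
    _ ≤ n * (n * r ^ 2) := by gcongr
    _ = _ := by ring

/-- Chaining along a sequence of nets. -/
lemma signMeanMax_le_of_nets (hn : 0 < n) (S : Finset (T → ℝ)) (hS : S.Nonempty) (t : Fin n → T)
    (N : ℕ) (V : ℕ → Finset (T → ℝ)) {h L : ℕ → ℝ} (hh : ∀ j, 0 < h j) (hL : Monotone L)
    (hV0 : (V 0).card = 1) (hcard : ∀ j, ((V j).card : ℝ) ≤ Real.exp (L j))
    (hV : ∀ j, ∀ f ∈ S, ∃ v ∈ V j, ∑ i, (f (t i) - v (t i)) ^ 2 ≤ n * h j ^ 2) :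
    signMeanMax S hS t ≤ h N + ∑ j ∈ Finset.range N, (h (j + 1) + h j) * (2 * √(L (j + 1) / n)) := by
  classical
  have hn0 : (0 : ℝ) < n := by exact_mod_cast hn
  choose! π hπ hπd using hV
  obtain ⟨v₀, hv₀⟩ := Finset.card_eq_one.1 hV0
  have hπ0 : ∀ f ∈ S, π 0 f = v₀ := fun f hf => by simpa [hv₀] using hπ 0 f hf
  set W : ℕ → Finset (T → ℝ) := fun j => S.image fun f => π (j + 1) f - π j f with hWdef
  have hW : ∀ j, (W j).Nonempty := fun j => hS.image _
  have hstep : ∀ j, signMeanMax (W j) (hW j) t ≤ (h (j + 1) + h j) * (2 * √(L (j + 1) / n)) := by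
    intro j
    have hc : ((W j).card : ℝ) ≤ Real.exp (2 * L (j + 1)) := by
      have h1 : (W j).card ≤ (V (j + 1) ×ˢ V j).card := by
        have : W j ⊆ (V (j + 1) ×ˢ V j).image fun p => p.1 - p.2 := by
          intro w hw
          obtain ⟨f, hf, rfl⟩ := Finset.mem_image.1 hw
          exact Finset.mem_image.2 ⟨(π (j + 1) f, π j f),
            Finset.mem_product.2 ⟨hπ _ f hf, hπ _ f hf⟩, rfl⟩
        exact (Finset.card_le_card this).trans Finset.card_image_le
      rw [Finset.card_product] at h1
      calc ((W j).card : ℝ) ≤ (V (j + 1)).card * (V j).card := by exact_mod_cast h1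
        _ ≤ Real.exp (L (j + 1)) * Real.exp (L (j + 1)) := by
            gcongr
            · exact hcard _
            · exact (hcard j).trans (Real.exp_le_exp.2 (hL (Nat.le_succ j)))
        _ = _ := by rw [← Real.exp_add, two_mul]
    refine (signMeanMax_le_of_card hn (W j) (hW j) t (add_pos (hh (j + 1)) (hh j)) hc ?_).trans
      (le_of_eq ?_)
    · intro w hw
      obtain ⟨f, hf, rfl⟩ := Finset.mem_image.1 hw
      exact sum_sq_sub_le_of_le (u := fun i => f (t i)) (v := fun i => π (j + 1) f (t i))
        (w := fun i => π j f (t i)) (hh _) (hh _) (hπd _ f hf) (hπd _ f hf)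
    · rw [show 2 * (2 * L (j + 1)) / n = 2 ^ 2 * (L (j + 1) / n) by ring,
        Real.sqrt_mul (by positivity), Real.sqrt_sq (by norm_num)]
  -- All chains start at the same `v₀`, whose signed mean averages to zero; Massart's bound with `Λ
  -- = 0` suffices. The `+ 1` in `r` keeps it positive.
  have hbase : signMeanMax {v₀} (Finset.singleton_nonempty v₀) t ≤ 0 := by
    set r := √(∑ i, v₀ (t i) ^ 2) + 1
    have hq : 0 ≤ ∑ i, v₀ (t i) ^ 2 := Finset.sum_nonneg fun i _ => sq_nonneg _
    have := signMeanMax_le_of_card hn {v₀} (Finset.singleton_nonempty v₀) t (r := r) (Λ := 0)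
      (by positivity) (by simp) (by
        intro w hw
        rw [Finset.mem_singleton.1 hw]
        have h1 : (1 : ℝ) ≤ n := by exact_mod_cast hn
        have h2 : ∑ i, v₀ (t i) ^ 2 ≤ r ^ 2 := by
          nlinarith [Real.sq_sqrt hq, Real.sqrt_nonneg (∑ i, v₀ (t i) ^ 2)]
        nlinarith [sq_nonneg r])
    simpa using this
  -- Telescope `f = (f - π N f) + ∑ (π (j + 1) f - π j f) + v₀` and bound the first term by
  -- Cauchy-Schwarz.
  have hpt : ∀ σ : Fin n → ℤˣ,
      S.sup' hS (fun f => (n : ℝ)⁻¹ * ∑ i, ((σ i : ℤ) : ℝ) * f (t i)) ≤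
      h N + ∑ j ∈ Finset.range N,
        (W j).sup' (hW j) (fun f => (n : ℝ)⁻¹ * ∑ i, ((σ i : ℤ) : ℝ) * f (t i)) +
      ({v₀} : Finset (T → ℝ)).sup' (Finset.singleton_nonempty v₀)
        (fun f => (n : ℝ)⁻¹ * ∑ i, ((σ i : ℤ) : ℝ) * f (t i)) := by
    intro σ
    set μ : (T → ℝ) → ℝ := fun f => (n : ℝ)⁻¹ * ∑ i, ((σ i : ℤ) : ℝ) * f (t i) with hμ
    have hμsub : ∀ f g, μ (f - g) = μ f - μ g := fun f g => by
      simp only [hμ, Pi.sub_apply, mul_sub, Finset.sum_sub_distrib]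
    refine Finset.sup'_le _ _ fun f hf => ?_
    rw [Finset.sup'_singleton]
    have h1 : μ (f - π N f) ≤ h N := mean_sign_mul_le hn σ (hh N).le (hπd N f hf)
    have h2 : ∑ j ∈ Finset.range N, μ (π (j + 1) f - π j f) ≤
        ∑ j ∈ Finset.range N, (W j).sup' (hW j) μ :=
      Finset.sum_le_sum fun j _ => Finset.le_sup' μ
        (Finset.mem_image_of_mem (fun f => π (j + 1) f - π j f) hf : _ ∈ W j)
    simp_rw [hμsub] at h1 h2
    rw [Finset.sum_range_sub (fun j => μ (π j f)), hπ0 f hf] at h2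
    linarith
  calc signMeanMax S hS t ≤ ((2 : ℝ) ^ n)⁻¹ * ∑ σ : Fin n → ℤˣ, (h N + ∑ j ∈ Finset.range N,
        (W j).sup' (hW j) (fun f => (n : ℝ)⁻¹ * ∑ i, ((σ i : ℤ) : ℝ) * f (t i)) +
      ({v₀} : Finset (T → ℝ)).sup' (Finset.singleton_nonempty v₀)
        (fun f => (n : ℝ)⁻¹ * ∑ i, ((σ i : ℤ) : ℝ) * f (t i))) := by
        unfold signMeanMax
        gcongr with σ _
        exact hpt σ
    _ = h N + ∑ j ∈ Finset.range N, signMeanMax (W j) (hW j) t +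
        signMeanMax {v₀} (Finset.singleton_nonempty v₀) t := by
        unfold signMeanMax
        rw [Finset.sum_add_distrib, Finset.sum_add_distrib, Finset.sum_comm, mul_add, mul_add,
          Finset.mul_sum (Finset.range N)]
        simp
    _ ≤ h N + ∑ j ∈ Finset.range N, (h (j + 1) + h j) * (2 * √(L (j + 1) / n)) + 0 := by
        gcongr with j _
        exact hstep j
    _ = _ := add_zero _

lemma rademacherComplexity_le [MeasurableSpace T] (P : Measure T) [IsProbabilityMeasure P]
    {F : Set (T → ℝ)} {b : ℝ} (hb : 0 ≤ b)
    (h : ∀ (S : Finset (T → ℝ)) (hS : S.Nonempty), (S : Set (T → ℝ)) ⊆ F →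
      ∀ t : Fin n → T, signMeanMax S hS t ≤ b) : rademacherComplexity P n F ≤ (b : EReal) := by
  refine iSup_le fun S => iSup_le fun hS => iSup_le fun hSF => ?_
  rw [EReal.coe_le_coe_iff]
  -- If the integrand is not integrable, its Bochner integral is 0 and `hb` concludes.
  by_cases hint : Integrable (fun t => signMeanMax S hS t) (Measure.pi fun _ : Fin n => P)
  · refine (integral_mono hint (integrable_const b) (h S hS hSF)).trans (le_of_eq ?_)
    simp
  · rw [integral_undef hint]
    exact hb

end Chaining

/-! ### Assembling the bound -/

lemma signMeanMax_squashedMarginClass_le {X : Type*} {C m : ℕ} (hC : 0 < C) (hm : 0 < m)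
    {M γ : ℝ} (hM : 0 < M) (hγ : 0 < γ) {G : Fin C → Set (X → ℝ)}
    (hG : ∀ k, ∀ g ∈ G k, ∀ x, g x ∈ Icc (-M) M) (hd : ∀ ε, 0 < ε → maxFatDim M G ε ≠ ⊤)
    {h : ℕ → ℝ} (hh : ∀ j, 0 < h j) (hanti : Antitone h) (h0 : γ ≤ h 0)
    (h1 : h 1 ≤ 2 * M * √(C : ℝ)) (N : ℕ) (S : Finset (X × Fin C → ℝ)) (hS : S.Nonempty)
    (hSF : (S : Set (X × Fin C → ℝ)) ⊆ squashedMarginClass G γ) (z : Fin m → X × Fin C) :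
    signMeanMax S hS z ≤ h N + 4 * √(5 * (C : ℝ) / (m : ℝ)) *
      ∑ j ∈ Finset.Icc 1 N, (h j + h (j - 1)) *
        √(((maxFatDim M G (h j / (96 * √(C : ℝ)))).toNat : ℝ) *
          Real.log (14 * M * √(C : ℝ) / h j)) := by
  have hs : 0 < √(C : ℝ) := Real.sqrt_pos.2 (by exact_mod_cast hC)
  set H : ℕ → ℝ := fun j => ((maxFatDim M G (h j / (96 * √(C : ℝ)))).toNat : ℝ) *
          Real.log (14 * M * √(C : ℝ) / h j) with hH
  have hle : ∀ j, 1 ≤ j → h j ≤ 2 * M * √(C : ℝ) := fun j hj => (hanti hj).trans h1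
  have hlog : ∀ j, 1 ≤ j → 0 ≤ Real.log (14 * M * √(C : ℝ) / h j) := fun j hj => by
    apply Real.log_nonneg
    rw [le_div_iff₀ (hh j)]
    nlinarith [hle j hj, mul_pos hM hs]
  have hdfin : ∀ j, maxFatDim M G (h j / (96 * √(C : ℝ))) ≠ ⊤ := fun j =>
    hd _ (div_pos (hh j) (by positivity))
  have hH0 : ∀ j, 1 ≤ j → 0 ≤ H j := fun j hj => mul_nonneg (by positivity) (hlog j hj)
  have hHmono : ∀ j, 1 ≤ j → H j ≤ H (j + 1) := fun j hj => by
    have hstep := hanti (Nat.le_succ j)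
    have := hh j
    have := hh (j + 1)
    refine mul_le_mul ?_ ?_ (hlog j hj) (by positivity)
    · have : maxFatDim M G (h j / (96 * √(C : ℝ))) ≤
          maxFatDim M G (h (j + 1) / (96 * √(C : ℝ))) := maxFatDim_anti M G (by gcongr)
      exact_mod_cast ENat.toNat_le_toNat this (hdfin (j + 1))
    · gcongr
  -- At scale `h 0 ≥ γ` the zero function alone is a net, since the class takes values in `[0, γ]`;
  -- the entropy bound is needed only from `j = 1`, where `h j ≤ 2 M √C`.
  set L : ℕ → ℝ := fun j => if j = 0 then 0 else 20 * C * H j with hL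
  have hLmono : Monotone L := by
    refine monotone_nat_of_le_succ fun j => ?_
    rcases Nat.eq_zero_or_pos j with rfl | hj
    · simp only [hL, if_true, zero_add, one_ne_zero, if_false]
      exact mul_nonneg (by positivity) (hH0 1 le_rfl)
    · simp only [hL, hj.ne', if_false, Nat.succ_ne_zero]
      exact mul_le_mul_of_nonneg_left (hHmono j hj) (by positivity)
  have hnets : ∀ j, ∃ V : Finset (X × Fin C → ℝ), (j = 0 → V.card = 1) ∧
      (V.card : ℝ) ≤ Real.exp (L j) ∧
      ∀ f ∈ squashedMarginClass G γ, ∃ v ∈ V, ∑ i, (f (z i) - v (z i)) ^ 2 ≤ m * h j ^ 2 := by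
    intro j
    rcases Nat.eq_zero_or_pos j with rfl | hj
    · refine ⟨{fun _ => 0}, fun _ => by simp, by simp [hL], fun f hf => ⟨_, Finset.mem_singleton_self _, ?_⟩⟩
      obtain ⟨g, -, rfl⟩ := hf
      have : ∀ i, (squash γ (marginFun g (z i)) - 0) ^ 2 ≤ h 0 ^ 2 := fun i => by
        rw [sub_zero]
        have := squash_mem_Icc hγ (marginFun g (z i))
        exact pow_le_pow_left₀ this.1 (this.2.trans h0) 2
      simpa using Finset.sum_le_card_nsmul Finset.univ _ _ fun i _ => this i
    · obtain ⟨V, hVc, hV⟩ := exists_net_squashedMarginClass hC hm z hM hγ (hh j) (hle j hj) hG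
        (ENat.natCast_toNat (hdfin j)).ge
      refine ⟨V, fun h => absurd h hj.ne', ?_, hV⟩
      simpa only [hL, hj.ne', if_false] using hVc
  choose V hV0 hVc hV using hnets
  refine (signMeanMax_le_of_nets hm S hS z N V hh hLmono (hV0 0 rfl) hVc
    fun j f hf => hV j f (hSF hf)).trans (le_of_eq ?_)
  congr 1
  rw [← Finset.Ico_succ_right_eq_Icc, Finset.mul_sum, Finset.sum_Ico_eq_sum_range]
  refine Finset.sum_congr (by simp) fun j _ => ?_
  -- Writing 20 as `2 ^ 2 * 5` turns the chaining factor 2 into the 4 of the statement.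
  have e : L (j + 1) / m = 2 ^ 2 * (5 * (C : ℝ) / m) * H (j + 1) := by
    simp only [hL, Nat.succ_ne_zero, if_false]
    ring
  rw [e, Real.sqrt_mul (by positivity), Real.sqrt_mul (by positivity),
    Real.sqrt_sq (by norm_num), add_comm 1 j, Nat.add_sub_cancel]
  ring

theorem theorem4 {X : Type*} [MeasurableSpace X] (C : ℕ) (hC : 3 ≤ C)
    (P : Measure (X × Fin C)) [IsProbabilityMeasure P]
    (M : ℝ) (hM : 1 ≤ M)
    (G : Fin C → Set (X → ℝ))
    (hGM : ∀ k, ∀ g ∈ G k, ∀ x, g x ∈ Icc (-M) M)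
    (hGC : ∀ k, IsUniformGC (G k))
    (γ : ℝ) (hγ0 : 0 < γ) (hγ1 : γ ≤ 1)
    (m : ℕ) (hm : 1 ≤ m) :
    (∀ ε : ℝ, 0 < ε → ε ≤ M → maxFatDim M G ε ≠ ⊤) ∧
    ∀ h : ℕ → ℝ, (∀ j, 0 < h j) → Antitone h → γ ≤ h 0 → h 1 ≤ 2 * M * √(C : ℝ) →
      ∀ N : ℕ, 1 ≤ N →
        rademacherComplexity P m (squashedMarginClass G γ) ≤
          ((h N + 4 * √(5 * (C : ℝ) / (m : ℝ)) *
            ∑ j ∈ Finset.Icc 1 N, (h j + h (j - 1)) *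
              √(((maxFatDim M G (h j / (96 * √(C : ℝ)))).toNat : ℝ) *
                Real.log (14 * M * √(C : ℝ) / h j)) : ℝ) : EReal) := by
  have hC0 : 0 < C := by omega
  have hM0 : 0 < M := by linarith
  have hfin : ∀ ε, 0 < ε → maxFatDim M G ε ≠ ⊤ := fun ε hε =>
    maxFatDim_ne_top hC0 hM0 hGM hGC hε
  refine ⟨fun ε hε _ => hfin ε hε, fun h hh hanti h0 h1 N _ => ?_⟩
  refine rademacherComplexity_le P ?_ fun S hS hSF z =>
    signMeanMax_squashedMarginClass_le hC0 hm hM0 hγ0 hGM hfin hh hanti h0 h1 N S hS hSF z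
  have : 0 ≤ ∑ j ∈ Finset.Icc 1 N, (h j + h (j - 1)) *
      √(((maxFatDim M G (h j / (96 * √(C : ℝ)))).toNat : ℝ) *
        Real.log (14 * M * √(C : ℝ) / h j)) :=
    Finset.sum_nonneg fun j _ =>
      mul_nonneg (add_pos (hh _) (hh _)).le (Real.sqrt_nonneg _)
  have := (hh N).le
  positivity
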